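/- \textbf{Theorem (Convergence of SOBA, decreasing step size).} Let $F=\frac1m\sum_{j=1}^mF_j$ and $G=\frac1n\sum_{i=1}^nG_i$ on $\mathbb{R}^p\times\mathbb{R}^d$ (Euclidean norms, operator norms for derivatives), where each $F_j$ is differentiable and each $G_i$ is twice differentiable. Let $\mu_G,C_F>0$, $L^F_1,L^G_1>0$, $L^F_2,L^G_2,L^G_3\ge 0$ and $B_z,B_v,B_x\in\mathbb{R}$. Assume: (1) $F$ is twice differentiable, and $\nabla F$, $\nabla^2F$ are Lipschitz in $(z,x)$ with constants $L^F_1$, $L^F_2$. (2) $G$ is three times continuously differentiable, $G(\cdot,x)$ is $\mu_G$-strongly convex for every $x$, and $\nabla G$, $\nabla^2G$, $\nabla^3G$ are Lipschitz in $(z,x)$ with constants $L^G_1$, $L^G_2$, $L^G_3$. Let $z^*(x)$ be the minimizer of $G(\cdot,x)$ and $h(x)=F(z^*(x),x)$. (3) $\|\nabla_1F(z^*(x),x)\|\le C_F$ for all $x$; and $h$ is bounded below. Put $D_z=\nabla_1G(z,x)$, $D_v=\nabla^2_{11}G(z,x)v+\nabla_1F(z,x)$, $D_x=\nabla^2_{21}G(z,x)v+\nabla_2F(z,x)$,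 where $\nabla^2_{21}G=(\partial^2 G/\partial x_a\partial z_b)_{a,b}\in\mathbb{R}^{d\times p}$. SOBA starts from a deterministic $(z^1,v^1,x^1)$. At each step $t\ge1$ it draws independent uniform indices $i_t\in\{1,\dots,n\}$, $j_t\in\{1,\dots,m\}$, independently over $t$, and sets $$z^{t+1}=z^t-\rho^tD_z^t,\qquad v^{t+1}=v^t-\rho^tD_v^t,\qquad x^{t+1}=x^t-\gamma^tD_x^t,$$ where $D_z^t,D_v^t,D_x^t$ are $D_z,D_v,D_x$ at $(z^t,v^t,x^t)$ with $G_{i_t},F_{j_t}$ in place of $G,F$. The steps are $\rho^t=\overline\rho\,t^{-1/2}$ and $\gamma^t=\xi\rho^t$, with arbitrary $\overline\rho>0$ and any $\xi>0$ such that $$\xi^2\le\frac{\mu_G}{4}\cdot\frac{\min(\phi_v',\phi_z')}{2L_x^2},$$ where $$\omega=L^F_1+\frac{L^G_2C_F}{\mu_G},\qquad L_x=\sqrt2\max(\omega,L^G_1),\qquad L_*=\max\Big(\tfrac{L^G_1}{\mu_G},\ \big(\tfrac{C_FL^G_2}{\mu_G^2}+\tfrac{L^F_1}{\mu_G}\big)\big(1+\tfrac{L^G_1}{\mu_G}\big)\Big),$$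 $$\overline\beta_{zx}=\frac{8L_*^2}{\mu_G},\qquad \overline\beta_{vx}=\frac{16L_*^2}{\mu_G},\qquad \beta_{vz}=\frac{\omega^2}{2\mu_G},\qquad \phi_z'=\frac1{8\overline\beta_{zx}},\qquad \phi_v'=\min\Big(\frac1{8\overline\beta_{vx}},\frac{\mu_G\phi_z'}{32\beta_{vz}}\Big).$$ Finally assume that for all $t\ge1$, with $\mathbb{E}_t$ the expectation conditional on $(z^t,v^t,x^t)$, almost surely: (4) $\mathbb{E}_t\|D_z^t\|^2\le B_z^2\big(1+\|D_z(z^t,v^t,x^t)\|^2\big)$ and $\mathbb{E}_t\|D_v^t\|^2\le B_v^2\big(1+\|D_v(z^t,v^t,x^t)\|^2\big)$; (5) $\mathbb{E}_t\|D_x^t\|^2\le B_x^2$. Then $h$ is differentiable and, as $T\to\infty$, $$\inf_{1\le t\le T}\mathbb{E}\big[\|\nabla h(x^t)\|^2\big]=O\big(\log(T)\,T^{-1/2}\big).$$ -/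

import Mathlib

open MeasureTheory ProbabilityTheory Filter Asymptotics
open scoped NNReal Topology

namespace SOBA

noncomputable section

/-- `ℝᵏ` with its Euclidean structure. -/
abbrev Vec (k : ℕ) : Type := EuclideanSpace ℝ (Fin k)

/-- The empirical mean `(1/n) ∑ᵢ Φᵢ(z, x)`. -/
def mean {n p d : ℕ} (Φ : Fin n → Vec p → Vec d → ℝ) (z : Vec p) (x : Vec d) : ℝ :=
  (1 / (n : ℝ)) * ∑ i, Φ i z x

/-- A function of `(z, x)` seen as a function on the Euclidean (ℓ²) product `ℝᵖ × ℝᵈ`. -/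
def joint {p d : ℕ} (Φ : Vec p → Vec d → ℝ) (w : WithLp 2 (Vec p × Vec d)) : ℝ :=
  Φ w.fst w.snd

/-- `∇₁Φ(z, x)`: gradient in `z`. -/
def grad1 {p d : ℕ} (Φ : Vec p → Vec d → ℝ) (z : Vec p) (x : Vec d) : Vec p :=
  gradient (fun z' => Φ z' x) z

/-- `∇₂Φ(z, x)`: gradient in `x`. -/
def grad2 {p d : ℕ} (Φ : Vec p → Vec d → ℝ) (z : Vec p) (x : Vec d) : Vec d :=
  gradient (fun x' => Φ z x') x

/-- `∇²₁₁Φ(z, x)`, as a linear map `ℝᵖ → ℝᵖ`. -/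
def hess11 {p d : ℕ} (Φ : Vec p → Vec d → ℝ) (z : Vec p) (x : Vec d) : Vec p →L[ℝ] Vec p :=
  fderiv ℝ (fun z' => grad1 Φ z' x) z

/-- `∇²₂₁Φ(z, x)`, as a linear map `ℝᵖ → ℝᵈ` (the matrix with entries `∂²Φ/∂xₐ∂z_b`). -/
def hess21 {p d : ℕ} (Φ : Vec p → Vec d → ℝ) (z : Vec p) (x : Vec d) : Vec p →L[ℝ] Vec d :=
  fderiv ℝ (fun z' => grad2 Φ z' x) z

/-- The inner solution `z*(x)`: a minimizer of `G(·, x)` (the minimizer, when `G(·, x)` is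
strongly convex and continuous). -/
def zStar {p d : ℕ} (G : Vec p → Vec d → ℝ) (x : Vec d) : Vec p :=
  Classical.epsilon fun z => ∀ z', G z x ≤ G z' x

/-- The value function `h(x) = F(z*(x), x)`. -/
def value {p d : ℕ} (F G : Vec p → Vec d → ℝ) (x : Vec d) : ℝ :=
  F (zStar G x) x

/-! ### Directions -/

/-- The state `(z, v, x)` of the algorithm. -/
abbrev State (p d : ℕ) : Type := Vec p × Vec p × Vec d

/-- `D_z(z, v, x) = ∇₁G(z, x)`. -/
def dirZ {p d : ℕ} (G : Vec p → Vec d → ℝ) (s : State p d) : Vec p :=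
  grad1 G s.1 s.2.2

/-- `D_v(z, v, x) = ∇²₁₁G(z, x) v + ∇₁F(z, x)`. -/
def dirV {p d : ℕ} (F G : Vec p → Vec d → ℝ) (s : State p d) : Vec p :=
  hess11 G s.1 s.2.2 s.2.1 + grad1 F s.1 s.2.2

/-- `D_x(z, v, x) = ∇²₂₁G(z, x) v + ∇₂F(z, x)`. -/
def dirX {p d : ℕ} (F G : Vec p → Vec d → ℝ) (s : State p d) : Vec d :=
  hess21 G s.1 s.2.2 s.2.1 + grad2 F s.1 s.2.2

/-! ### The algorithm

The stochastic directions are the directions of the pair `(F_j, G_i)`. -/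

/-- One SOBA step from `s`, with step sizes `ρ`, `γ` and sampled functions `F_j`, `G_i`. -/
def step {p d : ℕ} (Fj Gi : Vec p → Vec d → ℝ) (ρ γ : ℝ) (s : State p d) : State p d :=
  (s.1 - ρ • dirZ Gi s, s.2.1 - ρ • dirV Fj Gi s, s.2.2 - γ • dirX Fj Gi s)

/-- The SOBA iterates `(zᵗ, vᵗ, xᵗ)`, `t ≥ 1`, started from `(z¹, v¹, x¹) = s₁`; step `t ≥ 1` uses
`ρᵗ`, `γᵗ` and the sampled indices `iₜ`, `jₜ`. The value at `t = 0` is a dummy. -/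
def iterate {n m p d : ℕ} (F : Fin m → Vec p → Vec d → ℝ) (G : Fin n → Vec p → Vec d → ℝ)
    (ρ γ : ℕ → ℝ) (s₁ : State p d) (i : ℕ → Fin n) (j : ℕ → Fin m) : ℕ → State p d
  | 0 => s₁
  | 1 => s₁
  | t + 2 => step (F (j (t + 1))) (G (i (t + 1))) (ρ (t + 1)) (γ (t + 1))
      (iterate F G ρ γ s₁ i j (t + 1))

/-- The pairs `(iₜ, jₜ)` are independent over `t`, and for each `t` the indices `iₜ` and `jₜ` are
independent and uniform. -/
structure IsUniformSampling {Ω : Type*} [MeasurableSpace Ω] (P : Measure Ω) {n m : ℕ}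
    (i : ℕ → Ω → Fin n) (j : ℕ → Ω → Fin m) : Prop where
  measurable_i : ∀ t, Measurable (i t)
  measurable_j : ∀ t, Measurable (j t)
  uniform_i : ∀ t k, P.real {ω | i t ω = k} = 1 / n
  uniform_j : ∀ t k, P.real {ω | j t ω = k} = 1 / m
  indep_pair : ∀ t, IndepFun (i t) (j t) P
  indep_time : iIndepFun (fun t ω => (i t ω, j t ω)) P

/-- Conditional expectation `𝔼ₜ[Y]` given the random state `S = (zᵗ, vᵗ, xᵗ)`. -/
def condOn {Ω : Type*} [MeasurableSpace Ω] (P : Measure Ω) {p d : ℕ} (S : Ω → State p d)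
    (Y : Ω → ℝ) : Ω → ℝ :=
  P[Y | MeasurableSpace.comap S inferInstance]

/-! ### Regularity assumptions -/

/-- `F` is twice differentiable, and `∇F`, `∇²F` are Lipschitz in `(z, x)`. -/
structure OuterRegular {p d : ℕ} (F : Vec p → Vec d → ℝ) (L₁F L₂F : ℝ≥0) : Prop where
  differentiable : Differentiable ℝ (joint F)
  differentiable_gradient : Differentiable ℝ (gradient (joint F))
  lipschitz_gradient : LipschitzWith L₁F (gradient (joint F))
  lipschitz_hessian : LipschitzWith L₂F (fderiv ℝ (gradient (joint F)))

/-- `G` is `C³`, each `G(·, x)` is `μ`-strongly convex, and `∇G`, `∇²G`, `∇³G` are Lipschitz in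
`(z, x)`. -/
structure InnerRegular {p d : ℕ} (G : Vec p → Vec d → ℝ) (μ : ℝ) (L₁G L₂G L₃G : ℝ≥0) :
    Prop where
  contDiff : ContDiff ℝ 3 (joint G)
  strongConvex : ∀ x, StrongConvexOn Set.univ μ (fun z => G z x)
  lipschitz_gradient : LipschitzWith L₁G (gradient (joint G))
  lipschitz_hessian : LipschitzWith L₂G (fderiv ℝ (gradient (joint G)))
  lipschitz_third : LipschitzWith L₃G (fderiv ℝ (fderiv ℝ (gradient (joint G))))

/-! ### The constants that bound the step size ratio -/

/-- `ω = L₁F + L₂G C_F / μ`. -/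
def omegaC (μ CF L₁F L₂G : ℝ) : ℝ := L₁F + L₂G * CF / μ

/-- `L_*`, a Lipschitz constant of `z*` and `v*`. -/
def lStar (μ CF L₁F L₁G L₂G : ℝ) : ℝ :=
  max (L₁G / μ) (CF * L₂G / μ ^ 2 * (1 + L₁G / μ) + L₁F / μ * (1 + L₁G / μ))

/-- `L_x = √2 max(L₁F + C_F L₂G / μ, L₁G)`. -/
def lX (μ CF L₁F L₁G L₂G : ℝ) : ℝ := √2 * max (omegaC μ CF L₁F L₂G) L₁G

/-- `β_vz = ω² / (2μ)`. -/
def betaVZ (μ CF L₁F L₂G : ℝ) : ℝ := omegaC μ CF L₁F L₂G ^ 2 / (2 * μ)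

/-- `φ_z' = 1 / (8 β̄_zx)`, with `β̄_zx = 8 L_*² / μ`. -/
def phiZ (μ CF L₁F L₁G L₂G : ℝ) : ℝ := 1 / (8 * (8 * lStar μ CF L₁F L₁G L₂G ^ 2 / μ))

/-- `φ_v' = min(1 / (8 β̄_vx), μ φ_z' / (32 β_vz))`, with `β̄_vx = 16 L_*² / μ`. -/
def phiV (μ CF L₁F L₁G L₂G : ℝ) : ℝ :=
  min (1 / (8 * (16 * lStar μ CF L₁F L₁G L₂G ^ 2 / μ)))
    (μ * phiZ μ CF L₁F L₁G L₂G / (32 * betaVZ μ CF L₁F L₂G))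

/-- The bound `(μ/4) · min(φ_v', φ_z') / (2 L_x²)` on `ξ²`. -/
def xiSqMax (μ CF L₁F L₁G L₂G : ℝ) : ℝ :=
  μ / 4 * (min (phiV μ CF L₁F L₁G L₂G) (phiZ μ CF L₁F L₁G L₂G) *
    (1 / (2 * lX μ CF L₁F L₁G L₂G ^ 2)))

end

end SOBA

/-! The proof is a Lyapunov argument for $V=h(x)+c_z\|z-z^*(x)\|^2+c_v\|v-v^*(x)\|^2$, where
$v^*(x)$ solves $\nabla^2_{11}G\,v=-\nabla_1F$ at $(z^*(x),x)$, so that $D_x(z^*,v^*,x)=\nabla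
h(x)$.

The delicate point is that $z$, $v$ and $x$ move with step sizes of the same order. If the drift of
the targets $z^*(x^t)$, $v^*(x^t)$ were bounded by Lipschitz continuity alone, the noise in $x$
would enter at order $\gamma$. Instead both targets have first-order expansions with a uniformly
quadratic remainder (`quadExp_zStar`, `quadExp_vStar`). Averaging the linear term leaves only the
mean direction $D_x$, and the noise is pushed to order $\gamma^2$ (`sum_norm_sub_target_sq_le`).

The value function has such an expansion too (`exists_value_expansion`). Polarizing $\langle\nabla
h,D_x\rangle$ there gives $-\frac\gamma2\|\nabla
h\|^2-\frac\gamma2\|D_x\|^2+\frac\gamma2\|D_x-\nabla h\|^2$. The last term is controlled by the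
tracking errors, and the middle one pays for the target drift. Strong convexity contracts the
tracking errors; the choice of $\phi_z',\phi_v'$ and the bound on $\xi$ make the total first-order
drift negative (`drift_le`). What remains is $O(\rho^2)$, up to a factor $1+\|z-z^*\|^2+\|v-v^*\|^2$
whose quadratic part is absorbed by the drift once $\rho^t$ is small (`exists_lyapunov_descent`).

The indices take finitely many values, so every iterate has finite range: conditional expectations
are finite averages and integrability is automatic (`condExp_comp_indep`). Telescoping with
$\rho^t\sim t^{-1/2}$ compares $\sum t^{-1/2}\gtrsim\sqrt T$ with $\sum t^{-1}\lesssim\log T$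
(`isBigO_iInf_of_descent`). -/

namespace SOBA

/-! ### Second-order expansions -/

section QuadExp

variable {E F H : Type*} [NormedAddCommGroup E] [NormedSpace ℝ E] [NormedAddCommGroup F]
  [NormedSpace ℝ F] [NormedAddCommGroup H] [NormedSpace ℝ H]

/-- `f` has at each point a first-order expansion whose remainder is quadratic, uniformly. -/
def QuadExp (f : E → F) : Prop :=
  ∃ C : ℝ, 0 ≤ C ∧ ∀ x, ∃ J : E →L[ℝ] F, ∀ y, ‖f y - f x - J (y - x)‖ ≤ C * ‖y - x‖ ^ 2

theorem hasFDerivAt_of_quadratic_bound {f : E → F} {x : E} {J : E →L[ℝ] F} {C : ℝ}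
    (h : ∀ y, ‖f y - f x - J (y - x)‖ ≤ C * ‖y - x‖ ^ 2) : HasFDerivAt f J x := by
  rw [hasFDerivAt_iff_isLittleO]
  have h1 : (fun y => f y - f x - J (y - x)) =O[𝓝 x] fun y => ‖y - x‖ ^ 2 :=
    IsBigO.of_bound C (Eventually.of_forall fun y => by simpa using h y)
  refine h1.trans_isLittleO ?_
  have h2 : Tendsto (fun y => y - x) (𝓝 x) (𝓝 0) := by
    have : Continuous fun y : E => y - x := by fun_prop
    simpa using this.tendsto x
  have := (isLittleO_norm_pow_id (E' := E) (one_lt_two)).comp_tendsto h2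
  simpa [Function.comp_def] using this

/-- The quadratic remainder forces $J$ to be the derivative, so a Lipschitz constant of $f$ bounds
it. This is how $L_*$ controls the linear drift of the targets. -/
theorem norm_le_of_quadratic_bound {f : E → F} {x : E} {J : E →L[ℝ] F} {C : ℝ} {K : ℝ≥0}
    (hf : LipschitzWith K f)
    (h : ∀ y, ‖f y - f x - J (y - x)‖ ≤ C * ‖y - x‖ ^ 2) : ‖J‖ ≤ K := by
  rw [← (hasFDerivAt_of_quadratic_bound h).fderiv]
  exact norm_fderiv_le_of_lipschitz ℝ hf

/-- Mean value inequality on the segment, where the derivative varies by at most $L\|y-x\|$. The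
sharp factor $1/2$ is not needed. -/
theorem norm_sub_sub_fderiv_le {f : E → F} {L : ℝ≥0} (hf : Differentiable ℝ f)
    (hL : LipschitzWith L (fderiv ℝ f)) (x y : E) :
    ‖f y - f x - fderiv ℝ f x (y - x)‖ ≤ L * ‖y - x‖ ^ 2 := by
  have := (convex_segment x y).norm_image_sub_le_of_norm_fderiv_le' (𝕜 := ℝ) (f := f)
    (φ := fderiv ℝ f x) (C := L * ‖y - x‖) (fun z _ => hf z) (fun z hz => by
      rw [← dist_eq_norm]
      refine (hL.dist_le_mul z x).trans ?_
      gcongr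
      rw [dist_eq_norm]
      exact norm_sub_le_of_mem_segment hz)
    (left_mem_segment ℝ x y) (right_mem_segment ℝ x y)
  linarith

theorem QuadExp.of_lipschitz_fderiv {f : E → F} {L : ℝ≥0} (hf : Differentiable ℝ f)
    (hL : LipschitzWith L (fderiv ℝ f)) : QuadExp f :=
  ⟨L, L.2, fun x => ⟨fderiv ℝ f x, fun y => norm_sub_sub_fderiv_le hf hL x y⟩⟩

/-- The Lipschitz constants make the composed remainder uniform: $M$ turns $\|g(y)-g(x)\|^2$ into
$\|y-x\|^2$, and $K$ bounds the outer derivative at every point. -/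
theorem QuadExp.comp {f : F → H} {g : E → F} {K M : ℝ≥0} (hf : QuadExp f)
    (hfK : LipschitzWith K f) (hg : QuadExp g) (hgM : LipschitzWith M g) :
    QuadExp (f ∘ g) := by
  obtain ⟨Cf, hCf, hf⟩ := hf
  obtain ⟨Cg, hCg, hg⟩ := hg
  refine ⟨Cf * M ^ 2 + K * Cg, by positivity, fun x => ?_⟩
  obtain ⟨Jg, hJg⟩ := hg x
  obtain ⟨Jf, hJf⟩ := hf (g x)
  refine ⟨Jf.comp Jg, fun y => ?_⟩
  have e : (f ∘ g) y - (f ∘ g) x - (Jf.comp Jg) (y - x)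
      = (f (g y) - f (g x) - Jf (g y - g x)) + Jf (g y - g x - Jg (y - x)) := by
    simp only [Function.comp_apply, ContinuousLinearMap.comp_apply, map_sub]; abel
  rw [e]
  have h1 : ‖g y - g x‖ ≤ M * ‖y - x‖ := hgM.norm_sub_le y x
  calc _ ≤ Cf * ‖g y - g x‖ ^ 2 + ‖Jf‖ * ‖g y - g x - Jg (y - x)‖ :=
        (norm_add_le _ _).trans (add_le_add (hJf _) (Jf.le_opNorm _))
    _ ≤ Cf * (M * ‖y - x‖) ^ 2 + K * (Cg * ‖y - x‖ ^ 2) := by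
        gcongr
        · exact norm_le_of_quadratic_bound hfK hJf
        · exact hJg y
    _ = _ := by ring

theorem QuadExp.clm_comp {g : E → F} (T : F →L[ℝ] H) (hg : QuadExp g) :
    QuadExp fun x => T (g x) := by
  obtain ⟨Cg, hCg, hg⟩ := hg
  refine ⟨‖T‖ * Cg, by positivity, fun x => ?_⟩
  obtain ⟨Jg, hJg⟩ := hg x
  refine ⟨T.comp Jg, fun y => ?_⟩
  have e : T (g y) - T (g x) - (T.comp Jg) (y - x) = T (g y - g x - Jg (y - x)) := by simp
  rw [e, mul_assoc]
  exact (T.le_opNorm _).trans (by gcongr; exact hJg y)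

/-- Solutions `u x` of uniformly well-posed linear systems `A x (u x) = b x` inherit second-order
expansions from the data. -/
theorem QuadExp.of_solution {A : E → F →L[ℝ] F} {b u : E → F} {K : E → F →L[ℝ] F} {κ U : ℝ}
    {LA Lu : ℝ≥0} (hK : ∀ x v, K x (A x v) = v) (hκ : ∀ x v, ‖K x v‖ ≤ κ * ‖v‖) (hκ0 : 0 ≤ κ)
    (hsol : ∀ x, A x (u x) = b x) (hU : ∀ x, ‖u x‖ ≤ U) (hU0 : 0 ≤ U)
    (hA : QuadExp A) (hAL : LipschitzWith LA A) (hb : QuadExp b) (hu : LipschitzWith Lu u) :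
    QuadExp u := by
  obtain ⟨CA, hCA, hA⟩ := hA
  obtain ⟨Cb, hCb, hb⟩ := hb
  refine ⟨κ * (Cb + CA * U + LA * Lu), by positivity, fun x => ?_⟩
  obtain ⟨JA, hJA⟩ := hA x
  obtain ⟨Jb, hJb⟩ := hb x
  -- The candidate comes from formally differentiating $A(x)u(x)=b(x)$: $u'=K(b'-A'u)$.
  refine ⟨(K x).comp (Jb - JA.flip (u x)), fun y => ?_⟩
  have e : u y - u x - ((K x).comp (Jb - JA.flip (u x))) (y - x)
      = K x ((b y - b x - Jb (y - x)) - (A y - A x - JA (y - x)) (u x)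
        - (A y - A x) (u y - u x)) := by
    have h1 : u y - u x = K x (A x (u y - u x)) := (hK x _).symm
    nth_rewrite 1 [h1]
    rw [ContinuousLinearMap.comp_apply, ← map_sub]
    congr 1
    simp only [sub_apply, ContinuousLinearMap.flip_apply, map_sub, hsol]
    abel
  rw [e, mul_assoc]
  refine (hκ x _).trans (mul_le_mul_of_nonneg_left ?_ hκ0)
  have h1 := hJb y
  have h2 : ‖(A y - A x - JA (y - x)) (u x)‖ ≤ CA * ‖y - x‖ ^ 2 * U :=
    (ContinuousLinearMap.le_opNorm _ _).trans
      (mul_le_mul (hJA y) (hU x) (norm_nonneg _) (by positivity))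
  -- The only term not covered by the expansions of the data; it is quadratic because both factors
  -- are Lipschitz.
  have h3 : ‖(A y - A x) (u y - u x)‖ ≤ (LA * ‖y - x‖) * (Lu * ‖y - x‖) :=
    (ContinuousLinearMap.le_opNorm _ _).trans
      (mul_le_mul (hAL.norm_sub_le y x) (hu.norm_sub_le y x) (norm_nonneg _) (by positivity))
  have h4 := norm_sub_le ((b y - b x - Jb (y - x)) - (A y - A x - JA (y - x)) (u x))
    ((A y - A x) (u y - u x))
  have h5 := norm_sub_le (b y - b x - Jb (y - x)) ((A y - A x - JA (y - x)) (u x))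
  nlinarith

end QuadExp

/-! ### Coercive operators and strong convexity -/

section Convex

variable {E : Type*} [NormedAddCommGroup E] [InnerProductSpace ℝ E] [FiniteDimensional ℝ E]

/-- Coercivity bounds $A$ below by $\mu$, so it is injective, hence bijective in finite dimension;
the lower bound becomes the bound on the inverse. -/
theorem exists_inverse_of_coercive {A : E →L[ℝ] E} {μ : ℝ} (hμ : 0 < μ)
    (hA : ∀ u, μ * ‖u‖ ^ 2 ≤ inner ℝ (A u) u) :
    ∃ K : E →L[ℝ] E, (∀ u, K (A u) = u) ∧ (∀ u, A (K u) = u) ∧ ∀ u, ‖K u‖ ≤ μ⁻¹ * ‖u‖ := by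
  have hlow : ∀ u, μ * ‖u‖ ≤ ‖A u‖ := fun u => by
    rcases eq_or_ne u 0 with rfl | hu
    · simp
    · have h1 := (hA u).trans (real_inner_le_norm _ _)
      have h2 : 0 < ‖u‖ := norm_pos_iff.2 hu
      nlinarith
  have hinj : Function.Injective (A : E →ₗ[ℝ] E) := by
    rw [← LinearMap.ker_eq_bot, LinearMap.ker_eq_bot']
    intro u hu
    have h1 := hlow u
    have h2 : A u = 0 := hu
    rw [h2, norm_zero] at h1
    exact norm_le_zero_iff.1 (by nlinarith [norm_nonneg u])
  let e := LinearEquiv.ofInjectiveEndo (A : E →ₗ[ℝ] E) hinj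
  have h1 : ∀ u, e.symm (A u) = u := fun u => e.symm_apply_apply u
  have h2 : ∀ u, A (e.symm u) = u := fun u => e.apply_symm_apply u
  refine ⟨LinearMap.toContinuousLinearMap (e.symm : E →ₗ[ℝ] E), h1, h2, fun u => ?_⟩
  have h3 := hlow (e.symm u)
  rw [h2] at h3
  rw [inv_mul_eq_div, le_div_iff₀ hμ, mul_comm]
  exact h3

/-- Divide the strong convexity inequality on the segment from $z$ to $w$ by $t$ and let
$t\downarrow0$. -/
theorem StrongConvexOn.add_inner_le {f : E → ℝ} {μ : ℝ} (hf : StrongConvexOn Set.univ μ f)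
    {z g : E} (hg : HasGradientAt f g z) (w : E) :
    f z + inner ℝ g (w - z) + μ / 2 * ‖w - z‖ ^ 2 ≤ f w := by
  have hd : HasDerivAt (fun t : ℝ => f (z + t • (w - z))) (inner ℝ g (w - z)) 0 := by
    have h1 : HasDerivAt (fun t : ℝ => z + t • (w - z)) (w - z) 0 := by
      simpa using ((hasDerivAt_id (0 : ℝ)).smul_const (w - z)).const_add z
    have h2 : HasFDerivAt f (InnerProductSpace.toDual ℝ E g) (z + (0 : ℝ) • (w - z)) := by
      simpa using hg.hasFDerivAt
    have h3 := h2.comp_hasDerivAt (0 : ℝ) h1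
    rw [InnerProductSpace.toDual_apply_apply] at h3
    exact h3
  have h1 := (hasDerivAt_iff_tendsto_slope_zero.1 hd).mono_left
    (nhdsWithin_mono 0 (fun t (ht : t ∈ Set.Ioi (0 : ℝ)) => ne_of_gt ht))
  have h2 : Tendsto (fun t : ℝ => f w - f z - μ / 2 * (1 - t) * ‖w - z‖ ^ 2) (𝓝[>] 0)
      (𝓝 (f w - f z - μ / 2 * (1 - 0) * ‖w - z‖ ^ 2)) := by
    have : Continuous fun t : ℝ => f w - f z - μ / 2 * (1 - t) * ‖w - z‖ ^ 2 := by fun_prop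
    exact (this.tendsto 0).mono_left nhdsWithin_le_nhds
  obtain ⟨-, hf2⟩ := hf
  have h3 := le_of_tendsto_of_tendsto h1 h2 (by
    filter_upwards [Ioo_mem_nhdsGT (zero_lt_one (α := ℝ))] with t ht
    have h4 := hf2 (Set.mem_univ z) (Set.mem_univ w) (a := 1 - t) (b := t)
      (by linarith [ht.2]) ht.1.le (by ring)
    have h5 : (1 - t) • z + t • w = z + (0 + t) • (w - z) := by
      rw [zero_add]; module
    rw [h5] at h4
    simp only [smul_eq_mul, zero_smul, add_zero] at h4 ⊢
    rw [inv_mul_le_iff₀ ht.1, norm_sub_rev w z]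
    nlinarith)
  linarith

theorem StrongConvexOn.inner_sub_le {f : E → ℝ} {μ : ℝ} (hf : StrongConvexOn Set.univ μ f)
    {z w g g' : E} (hg : HasGradientAt f g z) (hg' : HasGradientAt f g' w) :
    μ * ‖z - w‖ ^ 2 ≤ inner ℝ (g - g') (z - w) := by
  have h1 := StrongConvexOn.add_inner_le hf hg w
  have h2 := StrongConvexOn.add_inner_le hf hg' z
  rw [← neg_sub z w, inner_neg_right, norm_neg] at h1
  rw [inner_sub_left]
  linarith

/-- The gradient inequality at $0$ gives quadratic growth, so $f$ tends to infinity and attains its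
infimum. -/
theorem StrongConvexOn.exists_minimizer {f : E → ℝ} {μ : ℝ} (hμ : 0 < μ)
    (hf : StrongConvexOn Set.univ μ f) (hd : Differentiable ℝ f) : ∃ z, ∀ w, f z ≤ f w := by
  refine hd.continuous.exists_forall_le ?_
  have hg := (hd 0).hasGradientAt
  set g := gradient f 0
  have h1 : ∀ w, f 0 + ‖w‖ * (μ / 2 * ‖w‖ - ‖g‖) ≤ f w := fun w => by
    have h2 := StrongConvexOn.add_inner_le hf hg w
    rw [sub_zero] at h2
    have h3 := neg_le_of_abs_le (abs_real_inner_le_norm g w)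
    nlinarith
  refine tendsto_atTop_mono h1 (tendsto_atTop_add_const_left _ _ ?_)
  have h4 : Tendsto (fun w : E => ‖w‖) (cocompact E) atTop := tendsto_norm_cocompact_atTop
  refine h4.atTop_mul_atTop₀ ?_
  exact tendsto_atTop_add_const_right _ _ (h4.const_mul_atTop (by positivity))

omit [FiniteDimensional ℝ E] in
theorem coercive_of_strong_monotone {g : E → E} {μ : ℝ} {z : E} {A : E →L[ℝ] E}
    (hg : HasFDerivAt g A z) (hmono : ∀ w, μ * ‖w - z‖ ^ 2 ≤ inner ℝ (g w - g z) (w - z)) (u : E) :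
    μ * ‖u‖ ^ 2 ≤ inner ℝ (A u) u := by
  have hd : HasDerivAt (fun t : ℝ => g (z + t • u)) (A u) 0 := by
    have h1 : HasDerivAt (fun t : ℝ => z + t • u) u 0 := by
      simpa using ((hasDerivAt_id (0 : ℝ)).smul_const u).const_add z
    have h2 : HasFDerivAt g A (z + (0 : ℝ) • u) := by simpa using hg
    exact h2.comp_hasDerivAt (0 : ℝ) h1
  have h1 := (hasDerivAt_iff_tendsto_slope_zero.1 hd).mono_left
    (nhdsWithin_mono 0 (fun t (ht : t ∈ Set.Ioi (0 : ℝ)) => ne_of_gt ht))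
  have h2 := h1.inner (𝕜 := ℝ) (tendsto_const_nhds (x := u))
  refine ge_of_tendsto h2 ?_
  filter_upwards [self_mem_nhdsWithin] with t (ht : 0 < t)
  have h3 := hmono (z + t • u)
  simp only [add_sub_cancel_left, norm_smul, inner_smul_right, Real.norm_eq_abs, mul_pow, sq_abs]
    at h3
  simp only [zero_add, zero_smul, add_zero, inner_smul_left, RCLike.conj_to_real]
  rw [le_inv_mul_iff₀ ht]
  nlinarith

end Convex

/-! ### Partial derivatives of functions on the Euclidean product -/

section Joint

variable {p d : ℕ}

/-- The point `(z, x)` of the Euclidean product. -/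
abbrev pt (z : Vec p) (x : Vec d) : WithLp 2 (Vec p × Vec d) := WithLp.toLp 2 (z, x)

/-- The inclusion `u ↦ (u, 0)`. -/
noncomputable def inlL (p d : ℕ) : Vec p →L[ℝ] WithLp 2 (Vec p × Vec d) :=
  ((WithLp.prodContinuousLinearEquiv 2 ℝ (Vec p) (Vec d)).symm :
    Vec p × Vec d →L[ℝ] WithLp 2 (Vec p × Vec d)).comp (ContinuousLinearMap.inl ℝ (Vec p) (Vec d))

/-- The inclusion `y ↦ (0, y)`. -/
noncomputable def inrL (p d : ℕ) : Vec d →L[ℝ] WithLp 2 (Vec p × Vec d) :=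
  ((WithLp.prodContinuousLinearEquiv 2 ℝ (Vec p) (Vec d)).symm :
    Vec p × Vec d →L[ℝ] WithLp 2 (Vec p × Vec d)).comp (ContinuousLinearMap.inr ℝ (Vec p) (Vec d))

theorem inlL_apply (u : Vec p) : inlL p d u = pt u 0 := rfl

theorem inrL_apply (y : Vec d) : inrL p d y = pt 0 y := rfl

theorem pt_eq (z : Vec p) (x : Vec d) : pt z x = inlL p d z + inrL p d x := by
  rw [inlL_apply, inrL_apply, ← WithLp.toLp_add]; simp

theorem pt_sub (z z' : Vec p) (x x' : Vec d) : pt z x - pt z' x' = pt (z - z') (x - x') := by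
  rw [← WithLp.toLp_sub]; rfl

theorem norm_pt_sq (z : Vec p) (x : Vec d) : ‖pt z x‖ ^ 2 = ‖z‖ ^ 2 + ‖x‖ ^ 2 :=
  WithLp.prod_norm_sq_eq_of_L2 _

theorem norm_inlL (u : Vec p) : ‖inlL p d u‖ = ‖u‖ := by
  have := norm_pt_sq u (0 : Vec d)
  rw [norm_zero, zero_pow two_ne_zero, add_zero] at this
  exact (sq_eq_sq₀ (norm_nonneg _) (norm_nonneg _)).1 this

theorem norm_inrL (y : Vec d) : ‖inrL p d y‖ = ‖y‖ := by
  have := norm_pt_sq (0 : Vec p) y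
  rw [norm_zero, zero_pow two_ne_zero, zero_add] at this
  exact (sq_eq_sq₀ (norm_nonneg _) (norm_nonneg _)).1 this

theorem norm_pt_le (z : Vec p) (x : Vec d) : ‖pt z x‖ ≤ ‖z‖ + ‖x‖ := by
  rw [pt_eq]; exact (norm_add_le _ _).trans_eq (by rw [norm_inlL, norm_inrL])

theorem norm_fst_le (w : WithLp 2 (Vec p × Vec d)) : ‖w.fst‖ ≤ ‖w‖ := by
  have := WithLp.prod_norm_sq_eq_of_L2 w
  exact le_of_sq_le_sq (by nlinarith [sq_nonneg ‖w.snd‖]) (norm_nonneg _)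

theorem norm_snd_le (w : WithLp 2 (Vec p × Vec d)) : ‖w.snd‖ ≤ ‖w‖ := by
  have := WithLp.prod_norm_sq_eq_of_L2 w
  exact le_of_sq_le_sq (by nlinarith [sq_nonneg ‖w.fst‖]) (norm_nonneg _)

theorem hasFDerivAt_pt_left (z : Vec p) (x : Vec d) :
    HasFDerivAt (fun z' => pt z' x) (inlL p d) z := by
  simp only [pt_eq]
  exact (inlL p d).hasFDerivAt.add_const _

theorem hasFDerivAt_pt_right (z : Vec p) (x : Vec d) :
    HasFDerivAt (fun x' => pt z x') (inrL p d) x := by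
  simp only [pt_eq]
  exact (inrL p d).hasFDerivAt.const_add _

variable {Φ : Vec p → Vec d → ℝ}

theorem hasGradientAt_left (h : Differentiable ℝ (joint Φ)) (z : Vec p) (x : Vec d) :
    HasGradientAt (fun z' => Φ z' x) (gradient (joint Φ) (pt z x)).fst z := by
  rw [hasGradientAt_iff_hasFDerivAt]
  have h1 := (h (pt z x)).hasGradientAt.hasFDerivAt.comp z (hasFDerivAt_pt_left z x)
  refine h1.congr_fderiv ?_
  ext u
  rw [ContinuousLinearMap.comp_apply, InnerProductSpace.toDual_apply_apply,
    InnerProductSpace.toDual_apply_apply, inlL_apply, WithLp.prod_inner_apply]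
  simp

theorem hasGradientAt_right (h : Differentiable ℝ (joint Φ)) (z : Vec p) (x : Vec d) :
    HasGradientAt (fun x' => Φ z x') (gradient (joint Φ) (pt z x)).snd x := by
  rw [hasGradientAt_iff_hasFDerivAt]
  have h1 := (h (pt z x)).hasGradientAt.hasFDerivAt.comp x (hasFDerivAt_pt_right z x)
  refine h1.congr_fderiv ?_
  ext u
  rw [ContinuousLinearMap.comp_apply, InnerProductSpace.toDual_apply_apply,
    InnerProductSpace.toDual_apply_apply, inrL_apply, WithLp.prod_inner_apply]
  simp

theorem grad1_eq (h : Differentiable ℝ (joint Φ)) (z : Vec p) (x : Vec d) :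
    grad1 Φ z x = (gradient (joint Φ) (pt z x)).fst :=
  (hasGradientAt_left h z x).gradient

theorem grad2_eq (h : Differentiable ℝ (joint Φ)) (z : Vec p) (x : Vec d) :
    grad2 Φ z x = (gradient (joint Φ) (pt z x)).snd :=
  (hasGradientAt_right h z x).gradient

theorem hasFDerivAt_grad1 (h : Differentiable ℝ (joint Φ))
    (h' : Differentiable ℝ (gradient (joint Φ))) (z : Vec p) (x : Vec d) :
    HasFDerivAt (fun z' => grad1 Φ z' x) ((WithLp.fstL 2 ℝ (Vec p) (Vec d)).comp
      ((fderiv ℝ (gradient (joint Φ)) (pt z x)).comp (inlL p d))) z := by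
  simp only [grad1_eq h]
  have h1 : HasFDerivAt (fun z' => gradient (joint Φ) (pt z' x))
      ((fderiv ℝ (gradient (joint Φ)) (pt z x)).comp (inlL p d)) z :=
    HasFDerivAt.comp (g := gradient (joint Φ)) (f := fun z' => pt z' x) z
      (h' (pt z x)).hasFDerivAt (hasFDerivAt_pt_left z x)
  exact (WithLp.fstL 2 ℝ (Vec p) (Vec d)).hasFDerivAt.comp z h1

theorem hasFDerivAt_grad2 (h : Differentiable ℝ (joint Φ))
    (h' : Differentiable ℝ (gradient (joint Φ))) (z : Vec p) (x : Vec d) :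
    HasFDerivAt (fun z' => grad2 Φ z' x) ((WithLp.sndL 2 ℝ (Vec p) (Vec d)).comp
      ((fderiv ℝ (gradient (joint Φ)) (pt z x)).comp (inlL p d))) z := by
  simp only [grad2_eq h]
  have h1 : HasFDerivAt (fun z' => gradient (joint Φ) (pt z' x))
      ((fderiv ℝ (gradient (joint Φ)) (pt z x)).comp (inlL p d)) z :=
    HasFDerivAt.comp (g := gradient (joint Φ)) (f := fun z' => pt z' x) z
      (h' (pt z x)).hasFDerivAt (hasFDerivAt_pt_left z x)
  exact (WithLp.sndL 2 ℝ (Vec p) (Vec d)).hasFDerivAt.comp z h1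

theorem hess11_eq (h : Differentiable ℝ (joint Φ)) (h' : Differentiable ℝ (gradient (joint Φ)))
    (z : Vec p) (x : Vec d) :
    hess11 Φ z x = (WithLp.fstL 2 ℝ (Vec p) (Vec d)).comp
      ((fderiv ℝ (gradient (joint Φ)) (pt z x)).comp (inlL p d)) :=
  (hasFDerivAt_grad1 h h' z x).fderiv

theorem hess21_eq (h : Differentiable ℝ (joint Φ)) (h' : Differentiable ℝ (gradient (joint Φ)))
    (z : Vec p) (x : Vec d) :
    hess21 Φ z x = (WithLp.sndL 2 ℝ (Vec p) (Vec d)).comp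
      ((fderiv ℝ (gradient (joint Φ)) (pt z x)).comp (inlL p d)) :=
  (hasFDerivAt_grad2 h h' z x).fderiv

theorem hess11_apply (h : Differentiable ℝ (joint Φ)) (h' : Differentiable ℝ (gradient (joint Φ)))
    (z : Vec p) (x : Vec d) (u : Vec p) :
    hess11 Φ z x u = (fderiv ℝ (gradient (joint Φ)) (pt z x) (inlL p d u)).fst := by
  rw [hess11_eq h h']; rfl

theorem hess21_apply (h : Differentiable ℝ (joint Φ)) (h' : Differentiable ℝ (gradient (joint Φ)))
    (z : Vec p) (x : Vec d) (u : Vec p) :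
    hess21 Φ z x u = (fderiv ℝ (gradient (joint Φ)) (pt z x) (inlL p d u)).snd := by
  rw [hess21_eq h h']; rfl

end Joint

/-! ### Inner problem: Hessian blocks and the solution map $z^*$ -/

section Regular

variable {p d : ℕ} {F G : Vec p → Vec d → ℝ} {μ CF : ℝ} {L₁F L₂F L₁G L₂G L₃G : ℝ≥0}

theorem gradient_eq_toDual_symm_comp {E : Type*} [NormedAddCommGroup E] [InnerProductSpace ℝ E]
    [CompleteSpace E] (f : E → ℝ) :
    gradient f = fun w => (InnerProductSpace.toDual ℝ E).symm (fderiv ℝ f w) := rfl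

theorem ContDiff.gradient_of_succ {E : Type*} [NormedAddCommGroup E] [InnerProductSpace ℝ E]
    [CompleteSpace E] {f : E → ℝ} {n m : WithTop ℕ∞} (hf : ContDiff ℝ n f) (h : m + 1 ≤ n) :
    ContDiff ℝ m (gradient f) := by
  rw [gradient_eq_toDual_symm_comp]
  exact ((InnerProductSpace.toDual ℝ E).symm.toContinuousLinearEquiv.contDiff).comp
    (hf.fderiv_right h)

/-- Schwarz's theorem, transported from the second derivative to the gradient by the Riesz isometry.
-/
theorem fderiv_gradient_symm {E : Type*} [NormedAddCommGroup E] [InnerProductSpace ℝ E]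
    [CompleteSpace E] {f : E → ℝ} (hf : ContDiff ℝ 2 f) (w a b : E) :
    inner ℝ (fderiv ℝ (gradient f) w a) b = inner ℝ a (fderiv ℝ (gradient f) w b) := by
  have hs : IsSymmSndFDerivAt ℝ f w := hf.contDiffAt.isSymmSndFDerivAt (by simp)
  have hd : Differentiable ℝ (gradient f) :=
    (ContDiff.gradient_of_succ (m := 1) hf (by norm_num)).differentiable (by norm_num)
  have e : ∀ a b, fderiv ℝ (fderiv ℝ f) w a b = inner ℝ (fderiv ℝ (gradient f) w a) b := by
    intro a b
    have h1 : fderiv ℝ f = fun w => InnerProductSpace.toDual ℝ E (gradient f w) := by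
      funext w; exact (toDual_gradient).symm
    have h2 : HasFDerivAt (fun w => InnerProductSpace.toDual ℝ E (gradient f w))
        ((InnerProductSpace.toDual ℝ E).toContinuousLinearEquiv.toContinuousLinearMap.comp
          (fderiv ℝ (gradient f) w)) w :=
      (InnerProductSpace.toDual ℝ E).toContinuousLinearEquiv.toContinuousLinearMap.hasFDerivAt.comp
        w (hd w).hasFDerivAt
    rw [h1, h2.fderiv]
    exact InnerProductSpace.toDual_apply_apply
  rw [← e, hs.eq, e, real_inner_comm]

namespace InnerRegular

variable (hG : InnerRegular G μ L₁G L₂G L₃G)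
include hG

theorem differentiable : Differentiable ℝ (joint G) := hG.contDiff.differentiable (by norm_num)

theorem contDiff_gradient : ContDiff ℝ 2 (gradient (joint G)) :=
  ContDiff.gradient_of_succ hG.contDiff (by norm_num)

theorem differentiable_gradient : Differentiable ℝ (gradient (joint G)) :=
  hG.contDiff_gradient.differentiable (by norm_num)

theorem differentiable_hessian : Differentiable ℝ (fderiv ℝ (gradient (joint G))) :=
  (hG.contDiff_gradient.fderiv_right (m := 1) (by norm_num)).differentiable (by norm_num)

theorem norm_hessian_le (w : WithLp 2 (Vec p × Vec d)) :
    ‖fderiv ℝ (gradient (joint G)) w‖ ≤ L₁G :=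
  norm_fderiv_le_of_lipschitz ℝ hG.lipschitz_gradient

theorem norm_hess11_apply_le (z : Vec p) (x : Vec d) (u : Vec p) :
    ‖hess11 G z x u‖ ≤ L₁G * ‖u‖ := by
  rw [hess11_apply hG.differentiable hG.differentiable_gradient]
  refine (norm_fst_le _).trans ((ContinuousLinearMap.le_opNorm _ _).trans ?_)
  rw [norm_inlL]
  exact mul_le_mul_of_nonneg_right (hG.norm_hessian_le _) (norm_nonneg _)

theorem norm_hess21_apply_le (z : Vec p) (x : Vec d) (u : Vec p) :
    ‖hess21 G z x u‖ ≤ L₁G * ‖u‖ := by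
  rw [hess21_apply hG.differentiable hG.differentiable_gradient]
  refine (norm_snd_le _).trans ((ContinuousLinearMap.le_opNorm _ _).trans ?_)
  rw [norm_inlL]
  exact mul_le_mul_of_nonneg_right (hG.norm_hessian_le _) (norm_nonneg _)

theorem norm_hess11_sub_apply_le (z z' : Vec p) (x x' : Vec d) (u : Vec p) :
    ‖hess11 G z x u - hess11 G z' x' u‖ ≤ L₂G * ‖pt z x - pt z' x'‖ * ‖u‖ := by
  rw [hess11_apply hG.differentiable hG.differentiable_gradient,
    hess11_apply hG.differentiable hG.differentiable_gradient, ← WithLp.sub_fst,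
    ← sub_apply]
  refine (norm_fst_le _).trans ((ContinuousLinearMap.le_opNorm _ _).trans ?_)
  rw [norm_inlL]
  exact mul_le_mul_of_nonneg_right (hG.lipschitz_hessian.norm_sub_le _ _) (norm_nonneg _)

theorem norm_hess21_sub_apply_le (z z' : Vec p) (x x' : Vec d) (u : Vec p) :
    ‖hess21 G z x u - hess21 G z' x' u‖ ≤ L₂G * ‖pt z x - pt z' x'‖ * ‖u‖ := by
  rw [hess21_apply hG.differentiable hG.differentiable_gradient,
    hess21_apply hG.differentiable hG.differentiable_gradient, ← WithLp.sub_snd,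
    ← sub_apply]
  refine (norm_snd_le _).trans ((ContinuousLinearMap.le_opNorm _ _).trans ?_)
  rw [norm_inlL]
  exact mul_le_mul_of_nonneg_right (hG.lipschitz_hessian.norm_sub_le _ _) (norm_nonneg _)

theorem norm_grad1_sub_le (z z' : Vec p) (x x' : Vec d) :
    ‖grad1 G z x - grad1 G z' x'‖ ≤ L₁G * ‖pt z x - pt z' x'‖ := by
  rw [grad1_eq hG.differentiable, grad1_eq hG.differentiable, ← WithLp.sub_fst]
  exact (norm_fst_le _).trans (hG.lipschitz_gradient.norm_sub_le _ _)

theorem hasGradientAt (z : Vec p) (x : Vec d) :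
    HasGradientAt (fun z' => G z' x) (grad1 G z x) z := by
  rw [grad1_eq hG.differentiable]; exact hasGradientAt_left hG.differentiable z x

theorem inner_grad1_sub_ge (z z' : Vec p) (x : Vec d) :
    μ * ‖z - z'‖ ^ 2 ≤ inner ℝ (grad1 G z x - grad1 G z' x) (z - z') :=
  StrongConvexOn.inner_sub_le (hG.strongConvex x) (hG.hasGradientAt z x) (hG.hasGradientAt z' x)

theorem inner_hess11_ge (z : Vec p) (x : Vec d) (u : Vec p) :
    μ * ‖u‖ ^ 2 ≤ inner ℝ (hess11 G z x u) u := by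
  rw [hess11_eq hG.differentiable hG.differentiable_gradient]
  exact coercive_of_strong_monotone
    (hasFDerivAt_grad1 hG.differentiable hG.differentiable_gradient z x)
    (fun w => hG.inner_grad1_sub_ge w z x) u

theorem inner_hess11_symm (z : Vec p) (x : Vec d) (u v : Vec p) :
    inner ℝ (hess11 G z x u) v = inner ℝ u (hess11 G z x v) := by
  have h := fderiv_gradient_symm (hG.contDiff.of_le (by norm_num)) (pt z x) (inlL p d u)
    (inlL p d v)
  rw [WithLp.prod_inner_apply, WithLp.prod_inner_apply] at h
  rw [hess11_apply hG.differentiable hG.differentiable_gradient,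
    hess11_apply hG.differentiable hG.differentiable_gradient]
  simpa [inlL_apply] using h

/-- Symmetry of mixed partials: the adjoint of $\nabla^2_{21}G$ is the derivative of $\nabla_1G$ in
$x$, the block that appears in the linearized optimality condition. -/
theorem inner_hess21 (z : Vec p) (x : Vec d) (v : Vec p) (y : Vec d) :
    inner ℝ (hess21 G z x v) y
      = inner ℝ v (fderiv ℝ (gradient (joint G)) (pt z x) (inrL p d y)).fst := by
  have h := fderiv_gradient_symm (hG.contDiff.of_le (by norm_num)) (pt z x) (inlL p d v)
    (inrL p d y)
  rw [WithLp.prod_inner_apply, WithLp.prod_inner_apply] at h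
  rw [hess21_apply hG.differentiable hG.differentiable_gradient]
  simpa [inlL_apply, inrL_apply] using h

variable (hμ : 0 < μ)
include hμ

theorem zStar_le (x : Vec d) (z : Vec p) : G (zStar G x) x ≤ G z x := by
  have hd : Differentiable ℝ fun z => G z x := fun z => (hG.hasGradientAt z x).differentiableAt
  have h := StrongConvexOn.exists_minimizer hμ (hG.strongConvex x) hd
  exact Classical.epsilon_spec h z

theorem grad1_zStar (x : Vec d) : grad1 G (zStar G x) x = 0 := by
  have h : IsLocalMin (fun z => G z x) (zStar G x) :=
    Eventually.of_forall (hG.zStar_le hμ x)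
  have h1 := h.hasFDerivAt_eq_zero (hG.hasGradientAt (zStar G x) x).hasFDerivAt
  exact (InnerProductSpace.toDual ℝ (Vec p)).map_eq_zero_iff.1 h1

theorem norm_zStar_sub_le (x y : Vec d) : ‖zStar G x - zStar G y‖ ≤ L₁G / μ * ‖x - y‖ := by
  have h1 := hG.inner_grad1_sub_ge (zStar G x) (zStar G y) y
  -- Both optimality conditions read $0$, so one can be exchanged for the other; what remains is the
  -- variation of $\nabla_1G(z^*(x),\cdot)$ in its second argument only.
  rw [hG.grad1_zStar hμ y, ← hG.grad1_zStar hμ x] at h1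
  have h2 := h1.trans (real_inner_le_norm _ _)
  have h3 := hG.norm_grad1_sub_le (zStar G x) (zStar G x) y x
  rw [pt_sub, sub_self, ← inrL_apply, norm_inrL, norm_sub_rev y x] at h3
  rw [div_mul_eq_mul_div, le_div_iff₀ hμ]
  rcases eq_or_ne (‖zStar G x - zStar G y‖) 0 with h0 | h0
  · rw [h0, zero_mul]; positivity
  · have h4 : 0 < ‖zStar G x - zStar G y‖ := lt_of_le_of_ne (norm_nonneg _) (Ne.symm h0)
    nlinarith [mul_le_mul_of_nonneg_right h3 h4.le]

theorem norm_pt_zStar_sub_le (x y : Vec d) :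
    ‖pt (zStar G x) x - pt (zStar G y) y‖ ≤ (1 + L₁G / μ) * ‖x - y‖ := by
  rw [pt_sub]
  refine (norm_pt_le _ _).trans ?_
  linarith [hG.norm_zStar_sub_le hμ x y]

theorem lipschitzWith_pt_zStar :
    LipschitzWith (Real.toNNReal (1 + L₁G / μ)) fun x => pt (zStar G x) x :=
  LipschitzWith.of_dist_le' fun x y => by
    rw [dist_eq_norm, dist_eq_norm]; exact hG.norm_pt_zStar_sub_le hμ x y

/-- The linearized optimality condition along `x ↦ (z*(x), x)` holds up to second order. -/
theorem norm_fst_hessian_pt_zStar_sub_le (x y : Vec d) :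
    ‖(fderiv ℝ (gradient (joint G)) (pt (zStar G x) x)
      (pt (zStar G y) y - pt (zStar G x) x)).fst‖ ≤ L₂G * (1 + L₁G / μ) ^ 2 * ‖y - x‖ ^ 2 := by
  have h1 := norm_sub_sub_fderiv_le hG.differentiable_gradient hG.lipschitz_hessian
    (pt (zStar G x) x) (pt (zStar G y) y)
  have h2 := (norm_fst_le _).trans h1
  rw [WithLp.sub_fst, WithLp.sub_fst, ← grad1_eq hG.differentiable, ← grad1_eq hG.differentiable,
    hG.grad1_zStar hμ, hG.grad1_zStar hμ, sub_self, zero_sub, norm_neg] at h2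
  refine h2.trans ?_
  rw [mul_assoc, ← mul_pow]
  gcongr
  exact hG.norm_pt_zStar_sub_le hμ y x

omit hμ in
theorem fst_hessian_pt_sub (z z' : Vec p) (x x' : Vec d) :
    (fderiv ℝ (gradient (joint G)) (pt z x) (pt z' x' - pt z x)).fst
      = hess11 G z x (z' - z)
        + (fderiv ℝ (gradient (joint G)) (pt z x) (inrL p d (x' - x))).fst := by
  rw [pt_sub, pt_eq (z' - z), map_add, WithLp.add_fst,
    hess11_apply hG.differentiable hG.differentiable_gradient]

/-- No implicit function theorem is needed: $z^*$ is already known to be Lipschitz, so the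
optimality condition linearizes with a quadratic error, and inverting $\nabla^2_{11}G$ isolates the
increment of $z^*$. -/
theorem quadExp_zStar : QuadExp (zStar G) := by
  refine ⟨μ⁻¹ * (L₂G * (1 + L₁G / μ) ^ 2), by positivity, fun x => ?_⟩
  obtain ⟨K, hKA, -, hK⟩ := exists_inverse_of_coercive hμ (hG.inner_hess11_ge (zStar G x) x)
  refine ⟨-(K.comp ((WithLp.fstL 2 ℝ (Vec p) (Vec d)).comp
    ((fderiv ℝ (gradient (joint G)) (pt (zStar G x) x)).comp (inrL p d)))), fun y => ?_⟩
  have h1 := hG.norm_fst_hessian_pt_zStar_sub_le hμ x y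
  rw [hG.fst_hessian_pt_sub] at h1
  have e : zStar G y - zStar G x - (-(K.comp ((WithLp.fstL 2 ℝ (Vec p) (Vec d)).comp
      ((fderiv ℝ (gradient (joint G)) (pt (zStar G x) x)).comp (inrL p d))))) (y - x)
      = K (hess11 G (zStar G x) x (zStar G y - zStar G x) +
        (fderiv ℝ (gradient (joint G)) (pt (zStar G x) x) (inrL p d (y - x))).fst) := by
    rw [map_add, hKA, neg_apply, sub_neg_eq_add]
    rfl
  rw [e, mul_assoc]
  exact (hK _).trans (mul_le_mul_of_nonneg_left h1 (by positivity))

theorem quadExp_pt_zStar : QuadExp fun x => pt (zStar G x) x := by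
  obtain ⟨C, hC, h⟩ := hG.quadExp_zStar hμ
  refine ⟨C, hC, fun x => ?_⟩
  obtain ⟨J, hJ⟩ := h x
  refine ⟨(inlL p d).comp J + inrL p d, fun y => ?_⟩
  have e : pt (zStar G y) y - pt (zStar G x) x - ((inlL p d).comp J + inrL p d) (y - x)
      = inlL p d (zStar G y - zStar G x - J (y - x)) := by
    rw [pt_sub (zStar G y), pt_eq (zStar G y - zStar G x), map_sub (inlL p d) (zStar G y - zStar G x), add_apply,
      ContinuousLinearMap.comp_apply]
    abel
  rw [e, norm_inlL]
  exact hJ y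

end InnerRegular

/-! ### Adjoint solution $v^*$ and gradient of the value function -/

/-- The solution of the linear system `∇²₁₁G(z*(x), x) v = -∇₁F(z*(x), x)`. -/
noncomputable def vStar (F G : Vec p → Vec d → ℝ) (x : Vec d) : Vec p :=
  Classical.epsilon fun v => hess11 G (zStar G x) x v = -grad1 F (zStar G x) x

/-- The directional formula for the gradient of the value function. -/
noncomputable def valueGrad (F G : Vec p → Vec d → ℝ) (x : Vec d) : Vec d :=
  dirX F G (zStar G x, vStar F G x, x)

theorem OuterRegular.norm_grad1_sub_le (hF : OuterRegular F L₁F L₂F) (z z' : Vec p) (x x' : Vec d) :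
    ‖grad1 F z x - grad1 F z' x'‖ ≤ L₁F * ‖pt z x - pt z' x'‖ := by
  rw [grad1_eq hF.differentiable, grad1_eq hF.differentiable, ← WithLp.sub_fst]
  exact (norm_fst_le _).trans (hF.lipschitz_gradient.norm_sub_le _ _)

theorem OuterRegular.norm_grad2_sub_le (hF : OuterRegular F L₁F L₂F) (z z' : Vec p) (x x' : Vec d) :
    ‖grad2 F z x - grad2 F z' x'‖ ≤ L₁F * ‖pt z x - pt z' x'‖ := by
  rw [grad2_eq hF.differentiable, grad2_eq hF.differentiable, ← WithLp.sub_snd]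
  exact (norm_snd_le _).trans (hF.lipschitz_gradient.norm_sub_le _ _)

variable (hF : OuterRegular F L₁F L₂F) (hG : InnerRegular G μ L₁G L₂G L₃G) (hμ : 0 < μ)

include hG hμ in
theorem hess11_vStar (x : Vec d) :
    hess11 G (zStar G x) x (vStar F G x) = -grad1 F (zStar G x) x := by
  obtain ⟨K, -, hAK, -⟩ := exists_inverse_of_coercive hμ (hG.inner_hess11_ge (zStar G x) x)
  exact Classical.epsilon_spec (p := fun v => hess11 G (zStar G x) x v = -grad1 F (zStar G x) x)
    ⟨K (-grad1 F (zStar G x) x), hAK _⟩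

variable (hbd : ∀ x, ‖grad1 F (zStar G x) x‖ ≤ CF)

include hG hμ hbd in
theorem norm_vStar_le (x : Vec d) : ‖vStar F G x‖ ≤ CF / μ := by
  obtain ⟨K, hKA, -, hK⟩ := exists_inverse_of_coercive hμ (hG.inner_hess11_ge (zStar G x) x)
  rw [← hKA (vStar F G x), hess11_vStar hG hμ, div_eq_inv_mul]
  refine (hK _).trans (mul_le_mul_of_nonneg_left ?_ (by positivity))
  rw [norm_neg]
  exact hbd x

include hF hG hμ hbd

/-- Subtract the linear systems at $x$ and $y$ and invert the Hessian at $x$. The constant is the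
second entry of the maximum defining $L_*$. -/
theorem norm_vStar_sub_le (x y : Vec d) : ‖vStar F G x - vStar F G y‖ ≤
    (CF * L₂G / μ ^ 2 * (1 + L₁G / μ) + L₁F / μ * (1 + L₁G / μ)) * ‖x - y‖ := by
  obtain ⟨K, hKA, -, hK⟩ := exists_inverse_of_coercive hμ (hG.inner_hess11_ge (zStar G x) x)
  have e : hess11 G (zStar G x) x (vStar F G x - vStar F G y)
      = -((grad1 F (zStar G x) x - grad1 F (zStar G y) y) + (hess11 G (zStar G x) x (vStar F G y)
        - hess11 G (zStar G y) y (vStar F G y))) := by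
    rw [map_sub, hess11_vStar hG hμ, hess11_vStar hG hμ]
    abel
  rw [← hKA (vStar F G x - vStar F G y), e]
  refine (hK _).trans ?_
  rw [norm_neg]
  have hw := hG.norm_pt_zStar_sub_le hμ x y
  have h1 := (hF.norm_grad1_sub_le (zStar G x) (zStar G y) x y).trans
    (mul_le_mul_of_nonneg_left hw L₁F.2)
  have h2 : ‖hess11 G (zStar G x) x (vStar F G y) - hess11 G (zStar G y) y (vStar F G y)‖
      ≤ L₂G * ((1 + L₁G / μ) * ‖x - y‖) * (CF / μ) :=
    (hG.norm_hess11_sub_apply_le _ _ _ _ _).trans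
      (mul_le_mul (mul_le_mul_of_nonneg_left hw L₂G.2) (norm_vStar_le hG hμ hbd y) (norm_nonneg _)
        (by positivity))
  calc _ ≤ μ⁻¹ * (L₁F * ((1 + L₁G / μ) * ‖x - y‖)
        + L₂G * ((1 + L₁G / μ) * ‖x - y‖) * (CF / μ)) :=
        mul_le_mul_of_nonneg_left ((norm_add_le _ _).trans (add_le_add h1 h2)) (by positivity)
    _ = _ := by field_simp; ring

/-- The data of the system solved by $v^*$ are $\nabla^2G$ and $\nabla F$ along
$x\mapsto(z^*(x),x)$. Their expansions are where Lipschitz continuity of $\nabla^3G$ and $\nabla^2F$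
is needed. -/
theorem quadExp_vStar : QuadExp (vStar F G) := by
  choose K hKA _ hK using fun x => exists_inverse_of_coercive hμ (hG.inner_hess11_ge (zStar G x) x)
  have hwL := hG.lipschitzWith_pt_zStar hμ
  have hw := hG.quadExp_pt_zStar hμ
  -- Extraction of the $(1,1)$ block of the full Hessian, as a fixed continuous linear map.
  let T : (WithLp 2 (Vec p × Vec d) →L[ℝ] WithLp 2 (Vec p × Vec d)) →L[ℝ] (Vec p →L[ℝ] Vec p) :=
    (ContinuousLinearMap.compL ℝ (Vec p) (WithLp 2 (Vec p × Vec d)) (Vec p)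
      (WithLp.fstL 2 ℝ (Vec p) (Vec d))).comp
    ((ContinuousLinearMap.compL ℝ (Vec p) (WithLp 2 (Vec p × Vec d))
      (WithLp 2 (Vec p × Vec d))).flip (inlL p d))
  have hA : (fun x => hess11 G (zStar G x) x)
      = fun x => T ((fderiv ℝ (gradient (joint G)) ∘ fun x => pt (zStar G x) x) x) := by
    funext x
    exact hess11_eq hG.differentiable hG.differentiable_gradient _ _
  have hb : (fun x => -grad1 F (zStar G x) x)
      = fun x => (-WithLp.fstL 2 ℝ (Vec p) (Vec d))
        ((gradient (joint F) ∘ fun x => pt (zStar G x) x) x) := by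
    funext x
    rw [grad1_eq hF.differentiable]; rfl
  have hDG : QuadExp (fderiv ℝ (gradient (joint G)) ∘ fun x => pt (zStar G x) x) :=
    (QuadExp.of_lipschitz_fderiv hG.differentiable_hessian hG.lipschitz_third).comp
      hG.lipschitz_hessian hw hwL
  have hDF : QuadExp (gradient (joint F) ∘ fun x => pt (zStar G x) x) :=
    (QuadExp.of_lipschitz_fderiv hF.differentiable_gradient hF.lipschitz_hessian).comp
      hF.lipschitz_gradient hw hwL
  have hu : LipschitzWith (Real.toNNReal _) (vStar F G) := LipschitzWith.of_dist_le' fun x y => by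
    rw [dist_eq_norm, dist_eq_norm]; exact norm_vStar_sub_le hF hG hμ hbd x y
  refine QuadExp.of_solution (A := fun x => hess11 G (zStar G x) x)
    (b := fun x => -grad1 F (zStar G x) x) (K := K) (κ := μ⁻¹) (U := CF / μ) hKA hK
    (by positivity) (hess11_vStar hG hμ) (norm_vStar_le hG hμ hbd)
    ((norm_nonneg _).trans (norm_vStar_le hG hμ hbd 0)) ?_
    (LA := ‖T‖₊ * (L₂G * (Real.toNNReal (1 + L₁G / μ)))) ?_ ?_ hu
  · rw [hA]; exact hDG.clm_comp T
  · rw [hA]; exact T.lipschitz.comp (hG.lipschitz_hessian.comp hwL)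
  · rw [hb]; exact hDF.clm_comp _

/-- Second-order expansion of the value function. -/
theorem exists_value_expansion : ∃ C : ℝ, 0 ≤ C ∧ ∀ x y,
    |value F G y - value F G x - inner ℝ (valueGrad F G x) (y - x)| ≤ C * ‖y - x‖ ^ 2 := by
  have hCF : 0 ≤ CF := (norm_nonneg _).trans (hbd 0)
  refine ⟨L₁F * (1 + L₁G / μ) ^ 2 + CF / μ * (L₂G * (1 + L₁G / μ) ^ 2), by positivity,
    fun x y => ?_⟩
  have hfd : LipschitzWith L₁F (fderiv ℝ (joint F)) := LipschitzWith.of_dist_le_mul fun w w' => by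
    rw [← toDual_gradient, ← toDual_gradient, LinearIsometryEquiv.dist_map]
    exact hF.lipschitz_gradient.dist_le_mul w w'
  have h1 := norm_sub_sub_fderiv_le hF.differentiable hfd (pt (zStar G x) x) (pt (zStar G y) y)
  have hw := hG.norm_pt_zStar_sub_le hμ y x
  have h2 := hG.norm_fst_hessian_pt_zStar_sub_le hμ x y
  have h3 : |inner ℝ (vStar F G x) (fderiv ℝ (gradient (joint G)) (pt (zStar G x) x)
      (pt (zStar G y) y - pt (zStar G x) x)).fst|
      ≤ CF / μ * (L₂G * (1 + L₁G / μ) ^ 2 * ‖y - x‖ ^ 2) :=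
    (abs_real_inner_le_norm _ _).trans (mul_le_mul (norm_vStar_le hG hμ hbd x) h2 (norm_nonneg _)
      (by positivity))
  have h4 : ‖joint F (pt (zStar G y) y) - joint F (pt (zStar G x) x)
      - fderiv ℝ (joint F) (pt (zStar G x) x) (pt (zStar G y) y - pt (zStar G x) x)‖
      ≤ L₁F * ((1 + L₁G / μ) * ‖y - x‖) ^ 2 := h1.trans (by gcongr)
  -- Exact adjoint identity: by symmetry of the Hessian, $v^*$ exchanges
  -- $\langle\nabla_1F,z^*(y)-z^*(x)\rangle$ for the linearized optimality residual, already known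
  -- to be quadratic. The derivative of $z^*$ never appears.
  have e : value F G y - value F G x - inner ℝ (valueGrad F G x) (y - x)
      = (joint F (pt (zStar G y) y) - joint F (pt (zStar G x) x)
      - fderiv ℝ (joint F) (pt (zStar G x) x) (pt (zStar G y) y - pt (zStar G x) x))
      - inner ℝ (vStar F G x) (fderiv ℝ (gradient (joint G)) (pt (zStar G x) x)
      (pt (zStar G y) y - pt (zStar G x) x)).fst := by
    rw [hG.fst_hessian_pt_sub, inner_add_right, ← hG.inner_hess21, ← hG.inner_hess11_symm]
    rw [hess11_vStar hG hμ, ← inner_gradient_left, WithLp.prod_inner_apply]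
    simp only [valueGrad, dirX, inner_add_left, inner_neg_left, grad1_eq hF.differentiable,
      grad2_eq hF.differentiable, pt_sub]
    simp only [value, joint, WithLp.fst, WithLp.snd]
    ring
  rw [e]
  rw [Real.norm_eq_abs] at h4
  refine (abs_sub _ _).trans ?_
  nlinarith

theorem hasGradientAt_value (x : Vec d) : HasGradientAt (value F G) (valueGrad F G x) x := by
  obtain ⟨C, -, hC⟩ := exists_value_expansion hF hG hμ hbd
  rw [hasGradientAt_iff_hasFDerivAt]
  refine hasFDerivAt_of_quadratic_bound (C := C) fun y => ?_
  rw [InnerProductSpace.toDual_apply_apply]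
  exact hC x y

/-! ### Errors of the directions -/

/-- The left side vanishes at $z=z^*(x)$. Moving $z$ costs $L^G_2\|v^*\|\le L^G_2C_F/\mu$ from the
Hessian and $L^F_1$ from the gradient, which add up to $\omega$. -/
theorem norm_grad1_add_hess11_vStar_le (z : Vec p) (x : Vec d) :
    ‖hess11 G z x (vStar F G x) + grad1 F z x‖ ≤ omegaC μ CF L₁F L₂G * ‖z - zStar G x‖ := by
  have e : hess11 G z x (vStar F G x) + grad1 F z x
      = (hess11 G z x (vStar F G x) - hess11 G (zStar G x) x (vStar F G x))
        + (grad1 F z x - grad1 F (zStar G x) x) := by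
    rw [hess11_vStar hG hμ]; abel
  have h1 := hG.norm_hess11_sub_apply_le z (zStar G x) x x (vStar F G x)
  have h2 := hF.norm_grad1_sub_le z (zStar G x) x x
  rw [pt_sub, sub_self, ← inlL_apply, norm_inlL] at h1 h2
  have h3 := h1.trans (mul_le_mul_of_nonneg_left (norm_vStar_le hG hμ hbd x) (by positivity))
  rw [e]
  refine (norm_add_le _ _).trans ((add_le_add h3 h2).trans_eq ?_)
  rw [omegaC]; ring

omit hF hG hμ hbd in
-- Splits $D_v$ into a part coercive in $v-v^*$ and a residual caused by the error in $z$ alone.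
theorem dirV_eq (s : State p d) :
    dirV F G s = hess11 G s.1 s.2.2 (s.2.1 - vStar F G s.2.2)
      + (hess11 G s.1 s.2.2 (vStar F G s.2.2) + grad1 F s.1 s.2.2) := by
  rw [dirV, map_sub]; abel

theorem inner_dirV_ge (s : State p d) :
    μ * ‖s.2.1 - vStar F G s.2.2‖ ^ 2
      - omegaC μ CF L₁F L₂G * ‖s.1 - zStar G s.2.2‖ * ‖s.2.1 - vStar F G s.2.2‖
      ≤ inner ℝ (s.2.1 - vStar F G s.2.2) (dirV F G s) := by
  rw [dirV_eq, inner_add_right, real_inner_comm (hess11 G _ _ _)]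
  have h1 := hG.inner_hess11_ge s.1 s.2.2 (s.2.1 - vStar F G s.2.2)
  have h2 := neg_le_of_abs_le (abs_real_inner_le_norm (s.2.1 - vStar F G s.2.2)
    (hess11 G s.1 s.2.2 (vStar F G s.2.2) + grad1 F s.1 s.2.2))
  have h3 := mul_le_mul_of_nonneg_left (norm_grad1_add_hess11_vStar_le hF hG hμ hbd s.1 s.2.2)
    (norm_nonneg (s.2.1 - vStar F G s.2.2))
  linarith

theorem norm_dirV_le (s : State p d) :
    ‖dirV F G s‖ ≤ L₁G * ‖s.2.1 - vStar F G s.2.2‖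
      + omegaC μ CF L₁F L₂G * ‖s.1 - zStar G s.2.2‖ := by
  rw [dirV_eq]
  exact (norm_add_le _ _).trans (add_le_add (hG.norm_hess11_apply_le _ _ _)
    (norm_grad1_add_hess11_vStar_le hF hG hμ hbd _ _))

theorem norm_dirX_sub_le (s : State p d) :
    ‖dirX F G s - valueGrad F G s.2.2‖ ≤ L₁G * ‖s.2.1 - vStar F G s.2.2‖
      + omegaC μ CF L₁F L₂G * ‖s.1 - zStar G s.2.2‖ := by
  obtain ⟨z, v, x⟩ := s
  dsimp only
  have e : dirX F G (z, v, x) - valueGrad F G x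
      = hess21 G z x (v - vStar F G x)
        + ((hess21 G z x (vStar F G x) - hess21 G (zStar G x) x (vStar F G x))
        + (grad2 F z x - grad2 F (zStar G x) x)) := by
    rw [valueGrad, dirX, dirX, map_sub]
    dsimp only
    abel
  have h1 := hG.norm_hess21_sub_apply_le z (zStar G x) x x (vStar F G x)
  have h2 := hF.norm_grad2_sub_le z (zStar G x) x x
  rw [pt_sub, sub_self, ← inlL_apply, norm_inlL] at h1 h2
  have h3 := h1.trans (mul_le_mul_of_nonneg_left (norm_vStar_le hG hμ hbd x) (by positivity))
  rw [e]
  refine (norm_add_le _ _).trans (add_le_add (hG.norm_hess21_apply_le _ _ _) ?_)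
  refine (norm_add_le _ _).trans ((add_le_add h3 h2).trans_eq ?_)
  rw [omegaC]; ring

omit hF hbd in
theorem inner_dirZ_ge (s : State p d) :
    μ * ‖s.1 - zStar G s.2.2‖ ^ 2 ≤ inner ℝ (s.1 - zStar G s.2.2) (dirZ G s) := by
  have h := hG.inner_grad1_sub_ge s.1 (zStar G s.2.2) s.2.2
  rwa [hG.grad1_zStar hμ, sub_zero, real_inner_comm] at h

omit hF hbd in
theorem norm_dirZ_le (s : State p d) : ‖dirZ G s‖ ≤ L₁G * ‖s.1 - zStar G s.2.2‖ := by
  have h := hG.norm_grad1_sub_le s.1 (zStar G s.2.2) s.2.2 s.2.2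
  rwa [hG.grad1_zStar hμ, sub_zero, pt_sub, sub_self, ← inlL_apply, norm_inlL] at h

end Regular

/-! ### One averaged step -/

section OneStep

variable {ι E X : Type*} [Fintype ι] [NormedAddCommGroup E] [InnerProductSpace ℝ E]
  [NormedAddCommGroup X] [InnerProductSpace ℝ X]

/-- Average squared tracking error after one step, for a target `y*` that is Lipschitz and has
second-order expansions. -/
theorem sum_norm_sub_target_sq_le {q : ι → ℝ} (hq : ∀ u, 0 ≤ q u) (hq1 : ∑ u, q u = 1)
    {f : X → E} {L : ℝ≥0} {C : ℝ} (hf : LipschitzWith L f)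
    {x : X} {J : X →L[ℝ] E} (hJ : ∀ y, ‖f y - f x - J (y - x)‖ ≤ C * ‖y - x‖ ^ 2)
    (y : E) (D : ι → E) (A : ι → X) {ρ γ : ℝ} (hγ : 0 ≤ γ) :
    ∑ u, q u * ‖y - ρ • D u - f (x - γ • A u)‖ ^ 2 ≤
      ‖y - f x‖ ^ 2 - 2 * ρ * inner ℝ (y - f x) (∑ u, q u • D u)
        + 2 * γ * L * ‖y - f x‖ * ‖∑ u, q u • A u‖ + 2 * ρ ^ 2 * ∑ u, q u * ‖D u‖ ^ 2
        + (2 * L ^ 2 + 2 * C * ‖y - f x‖) * γ ^ 2 * ∑ u, q u * ‖A u‖ ^ 2 := by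
  set a := y - f x with ha
  have hJL := norm_le_of_quadratic_bound hf hJ
  -- The term linear in $A_u$ is kept as $J(A_u)$, with no norm taken yet, so that averaging
  -- replaces it by $J$ of the mean direction.
  have h1 : ∀ u, ‖y - ρ • D u - f (x - γ • A u)‖ ^ 2 ≤ ‖a‖ ^ 2 - 2 * ρ * inner ℝ a (D u)
      + 2 * γ * inner ℝ a (J (A u)) + 2 * ρ ^ 2 * ‖D u‖ ^ 2
      + (2 * L ^ 2 + 2 * C * ‖a‖) * γ ^ 2 * ‖A u‖ ^ 2 := by
    intro u
    set e := f (x - γ • A u) - f x with he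
    have e1 : y - ρ • D u - f (x - γ • A u) = a - (ρ • D u + e) := by rw [ha, he]; abel
    have h2 : ‖e‖ ≤ L * (γ * ‖A u‖) := by
      have := hf.norm_sub_le (x - γ • A u) x
      rwa [sub_sub_cancel_left, norm_neg, norm_smul, Real.norm_of_nonneg hγ] at this
    have h3 := hJ (x - γ • A u)
    rw [sub_sub_cancel_left, norm_neg, norm_smul, Real.norm_of_nonneg hγ, map_neg, map_smul,
      sub_neg_eq_add, ← he] at h3
    have h4 := neg_le_of_abs_le (abs_real_inner_le_norm a (e + γ • J (A u)))
    have h5 := mul_le_mul_of_nonneg_left h3 (norm_nonneg a)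
    rw [inner_add_right, inner_smul_right] at h4
    have h6 : ‖ρ • D u + e‖ ^ 2 ≤ 2 * (ρ ^ 2 * ‖D u‖ ^ 2) + 2 * (L * (γ * ‖A u‖)) ^ 2 := by
      have h7 := parallelogram_law_with_norm ℝ (ρ • D u) e
      have h8 : ‖ρ • D u‖ ^ 2 = ρ ^ 2 * ‖D u‖ ^ 2 := by
        rw [norm_smul, mul_pow, Real.norm_eq_abs, sq_abs]
      have h9 := pow_le_pow_left₀ (norm_nonneg e) h2 2
      nlinarith [mul_self_nonneg ‖ρ • D u - e‖]
    rw [e1, norm_sub_sq_real, inner_add_right, inner_smul_right]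
    nlinarith
  have h2 : ∑ u, q u * ‖y - ρ • D u - f (x - γ • A u)‖ ^ 2 ≤ ∑ u, q u * (‖a‖ ^ 2
      - 2 * ρ * inner ℝ a (D u) + 2 * γ * inner ℝ a (J (A u)) + 2 * ρ ^ 2 * ‖D u‖ ^ 2
      + (2 * L ^ 2 + 2 * C * ‖a‖) * γ ^ 2 * ‖A u‖ ^ 2) :=
    Finset.sum_le_sum fun u _ => mul_le_mul_of_nonneg_left (h1 u) (hq u)
  have h3 : ∑ u, q u * (‖a‖ ^ 2
      - 2 * ρ * inner ℝ a (D u) + 2 * γ * inner ℝ a (J (A u)) + 2 * ρ ^ 2 * ‖D u‖ ^ 2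
      + (2 * L ^ 2 + 2 * C * ‖a‖) * γ ^ 2 * ‖A u‖ ^ 2)
      = ‖a‖ ^ 2 - 2 * ρ * inner ℝ a (∑ u, q u • D u)
        + 2 * γ * inner ℝ a (J (∑ u, q u • A u)) + 2 * ρ ^ 2 * ∑ u, q u * ‖D u‖ ^ 2
        + (2 * L ^ 2 + 2 * C * ‖a‖) * γ ^ 2 * ∑ u, q u * ‖A u‖ ^ 2 := by
    simp only [map_sum, map_smul, inner_sum, inner_smul_right, Finset.mul_sum]
    have hc : ‖a‖ ^ 2 = ∑ u, q u * ‖a‖ ^ 2 := by rw [← Finset.sum_mul, hq1, one_mul]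
    conv_rhs => rw [hc]
    rw [← Finset.sum_sub_distrib, ← Finset.sum_add_distrib, ← Finset.sum_add_distrib,
      ← Finset.sum_add_distrib]
    exact Finset.sum_congr rfl fun u _ => by ring
  have h4 : inner ℝ a (J (∑ u, q u • A u)) ≤ ‖a‖ * (L * ‖∑ u, q u • A u‖) :=
    (real_inner_le_norm _ _).trans (mul_le_mul_of_nonneg_left (J.le_of_opNorm_le hJL _)
      (norm_nonneg _))
  rw [h3] at h2
  nlinarith

theorem sum_expansion_le {q : ι → ℝ} (hq : ∀ u, 0 ≤ q u) (hq1 : ∑ u, q u = 1)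
    {h : X → ℝ} {x g : X} {C : ℝ} (hh : ∀ y, |h y - h x - inner ℝ g (y - x)| ≤ C * ‖y - x‖ ^ 2)
    (A : ι → X) (γ : ℝ) :
    ∑ u, q u * h (x - γ • A u) ≤ h x - γ * inner ℝ g (∑ u, q u • A u)
      + C * γ ^ 2 * ∑ u, q u * ‖A u‖ ^ 2 := by
  have h1 : ∀ u, h (x - γ • A u) ≤ h x - γ * inner ℝ g (A u) + C * γ ^ 2 * ‖A u‖ ^ 2 := by
    intro u
    have := le_of_abs_le (hh (x - γ • A u))
    rw [sub_sub_cancel_left, norm_neg, norm_smul, mul_pow, Real.norm_eq_abs, sq_abs,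
      inner_neg_right, inner_smul_right] at this
    linarith
  refine (Finset.sum_le_sum fun u _ => mul_le_mul_of_nonneg_left (h1 u) (hq u)).trans_eq ?_
  simp only [inner_sum, inner_smul_right, Finset.mul_sum]
  have hc : h x = ∑ u, q u * h x := by rw [← Finset.sum_mul, hq1, one_mul]
  conv_rhs => rw [hc]
  rw [← Finset.sum_sub_distrib, ← Finset.sum_add_distrib]
  exact Finset.sum_congr rfl fun u _ => by ring

end OneStep

/-- The negative drift of the Lyapunov function. -/
theorem drift_le {μ ω L φz φv ξ Lx a b N : ℝ} (hμ : 0 < μ) (hφz : 0 ≤ φz) (hφv : 0 ≤ φv)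
    (h1 : 64 * (φz * L ^ 2) ≤ μ) (h2 : 128 * (φv * L ^ 2) ≤ μ)
    (h3 : 16 * (φv * ω ^ 2) ≤ μ ^ 2 * φz)
    (h4 : 8 * (ξ ^ 2 * Lx ^ 2) ≤ μ * φz) (h5 : 8 * (ξ ^ 2 * Lx ^ 2) ≤ μ * φv) :
    ξ ^ 2 / 2 * (Lx ^ 2 * (a ^ 2 + b ^ 2) - N ^ 2)
      + φz * (-2 * (μ * a ^ 2) + 2 * ξ * L * a * N)
      + φv * (-2 * (μ * b ^ 2 - ω * a * b) + 2 * ξ * L * b * N)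
      ≤ -(μ / 2 * φz * a ^ 2 + μ / 2 * φv * b ^ 2) := by
  -- The Young weights are such that the two cross terms together consume exactly the available
  -- $-\xi^2N^2/2$.
  have e1 : 2 * (φz * L * a) * (ξ * N) ≤ (ξ * N) ^ 2 / 4 + 4 * (φz * L * a) ^ 2 := by
    nlinarith [sq_nonneg (ξ * N / 2 - 2 * (φz * L * a))]
  have e2 : 2 * (φv * L * b) * (ξ * N) ≤ (ξ * N) ^ 2 / 4 + 4 * (φv * L * b) ^ 2 := by
    nlinarith [sq_nonneg (ξ * N / 2 - 2 * (φv * L * b))]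
  have e3 : 4 * (φz * L * a) ^ 2 ≤ μ * φz * a ^ 2 / 16 := by
    have := mul_le_mul_of_nonneg_right h1 (mul_nonneg hφz (sq_nonneg a))
    nlinarith
  have e4 : 4 * (φv * L * b) ^ 2 ≤ μ * φv * b ^ 2 / 32 := by
    have := mul_le_mul_of_nonneg_right h2 (mul_nonneg hφv (sq_nonneg b))
    nlinarith
  -- Half of the contraction $2\mu\phi_vb^2$ is spent on the coupling. The rest is charged to $a^2$
  -- at the price $\phi_v\omega^2/\mu$, which is why $\phi_v'$ must be small relative to $\phi_z'$.
  have e5 : 2 * φv * (ω * a * b) ≤ μ * φv * b ^ 2 + μ * φz * a ^ 2 / 16 := by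
    have h6 : 2 * (ω * a * b) ≤ μ * b ^ 2 + ω ^ 2 * a ^ 2 / μ := by
      have : 0 ≤ (μ * b - ω * a) ^ 2 / μ := by positivity
      have h7 : (μ * b - ω * a) ^ 2 / μ = μ * b ^ 2 + ω ^ 2 * a ^ 2 / μ - 2 * (ω * a * b) := by
        field_simp; ring
      linarith
    have h8 : φv * (ω ^ 2 * a ^ 2 / μ) ≤ μ * φz * a ^ 2 / 16 := by
      have h9 := mul_le_mul_of_nonneg_right h3 (sq_nonneg a)
      rw [← mul_div_assoc, div_le_iff₀ hμ]
      nlinarith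
    nlinarith [mul_le_mul_of_nonneg_left h6 hφv]
  have e6 := mul_le_mul_of_nonneg_right h4 (sq_nonneg a)
  have e7 := mul_le_mul_of_nonneg_right h5 (sq_nonneg b)
  have e8 : 0 ≤ μ * φz * a ^ 2 := by positivity
  have e9 : 0 ≤ μ * φv * b ^ 2 := by positivity
  linarith

/-! ### Inequalities between the constants -/

section Constants

variable {μ CF L₁F L₁G L₂G : ℝ}

theorem omegaC_pos (hμ : 0 < μ) (hCF : 0 < CF) (hL₁F : 0 < L₁F) (hL₂G : 0 ≤ L₂G) :
    0 < omegaC μ CF L₁F L₂G := by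
  rw [omegaC]; positivity

theorem lStar_pos (hμ : 0 < μ) (hL₁G : 0 < L₁G) : 0 < lStar μ CF L₁F L₁G L₂G :=
  lt_max_of_lt_left (by positivity)

theorem phiZ_pos (hμ : 0 < μ) (hL₁G : 0 < L₁G) : 0 < phiZ μ CF L₁F L₁G L₂G := by
  have := lStar_pos (CF := CF) (L₁F := L₁F) (L₂G := L₂G) hμ hL₁G
  rw [phiZ]; positivity

theorem phiV_pos (hμ : 0 < μ) (hCF : 0 < CF) (hL₁F : 0 < L₁F) (hL₁G : 0 < L₁G) (hL₂G : 0 ≤ L₂G) :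
    0 < phiV μ CF L₁F L₁G L₂G := by
  have h1 := lStar_pos (CF := CF) (L₁F := L₁F) (L₂G := L₂G) hμ hL₁G
  have h2 := omegaC_pos hμ hCF hL₁F hL₂G
  have h3 := phiZ_pos (CF := CF) (L₁F := L₁F) (L₂G := L₂G) hμ hL₁G
  rw [phiV, betaVZ]
  exact lt_min (by positivity) (by positivity)

theorem phiZ_mul_lStar_sq (hμ : 0 < μ) (hL₁G : 0 < L₁G) :
    64 * (phiZ μ CF L₁F L₁G L₂G * lStar μ CF L₁F L₁G L₂G ^ 2) = μ := by
  have := (lStar_pos (CF := CF) (L₁F := L₁F) (L₂G := L₂G) hμ hL₁G).ne'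
  rw [phiZ]; field_simp; norm_num

theorem phiV_mul_lStar_sq_le (hμ : 0 < μ) (hL₁G : 0 < L₁G) :
    128 * (phiV μ CF L₁F L₁G L₂G * lStar μ CF L₁F L₁G L₂G ^ 2) ≤ μ := by
  have h := lStar_pos (CF := CF) (L₁F := L₁F) (L₂G := L₂G) hμ hL₁G
  have h1 : phiV μ CF L₁F L₁G L₂G ≤ 1 / (8 * (16 * lStar μ CF L₁F L₁G L₂G ^ 2 / μ)) :=
    min_le_left _ _
  calc _ ≤ 128 * (1 / (8 * (16 * lStar μ CF L₁F L₁G L₂G ^ 2 / μ)) * lStar μ CF L₁F L₁G L₂G ^ 2) := by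
        gcongr
    _ = μ := by field_simp; norm_num

theorem phiV_mul_omegaC_sq_le (hμ : 0 < μ) (hCF : 0 < CF) (hL₁F : 0 < L₁F) (hL₂G : 0 ≤ L₂G) :
    16 * (phiV μ CF L₁F L₁G L₂G * omegaC μ CF L₁F L₂G ^ 2) ≤ μ ^ 2 * phiZ μ CF L₁F L₁G L₂G := by
  have h := omegaC_pos hμ hCF hL₁F hL₂G
  have h1 : phiV μ CF L₁F L₁G L₂G
      ≤ μ * phiZ μ CF L₁F L₁G L₂G / (32 * (omegaC μ CF L₁F L₂G ^ 2 / (2 * μ))) :=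
    min_le_right _ _
  calc _ ≤ 16 * (μ * phiZ μ CF L₁F L₁G L₂G / (32 * (omegaC μ CF L₁F L₂G ^ 2 / (2 * μ)))
        * omegaC μ CF L₁F L₂G ^ 2) := by gcongr
    _ = _ := by field_simp; ring

theorem sq_mul_lX_sq_le {ξ : ℝ} (hL₁G : 0 < L₁G) (h : ξ ^ 2 ≤ xiSqMax μ CF L₁F L₁G L₂G) :
    8 * (ξ ^ 2 * lX μ CF L₁F L₁G L₂G ^ 2)
      ≤ μ * min (phiV μ CF L₁F L₁G L₂G) (phiZ μ CF L₁F L₁G L₂G) := by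
  have h1 : 0 < lX μ CF L₁F L₁G L₂G := by
    rw [lX]; exact mul_pos (by positivity) (lt_max_of_lt_right hL₁G)
  have h2 := mul_le_mul_of_nonneg_right h (sq_nonneg (lX μ CF L₁F L₁G L₂G))
  have h3 : xiSqMax μ CF L₁F L₁G L₂G * lX μ CF L₁F L₁G L₂G ^ 2
      = μ * min (phiV μ CF L₁F L₁G L₂G) (phiZ μ CF L₁F L₁G L₂G) / 8 := by
    rw [xiSqMax]; field_simp; ring
  linarith

/-- The $\sqrt2$ in $L_x$ comes from $(s+t)^2\le2s^2+2t^2$. -/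
theorem sq_le_lX_sq_mul (hω : 0 ≤ omegaC μ CF L₁F L₂G) (hL₁G : 0 ≤ L₁G) (a b : ℝ) :
    (L₁G * b + omegaC μ CF L₁F L₂G * a) ^ 2 ≤ lX μ CF L₁F L₁G L₂G ^ 2 * (a ^ 2 + b ^ 2) := by
  rw [lX, mul_pow, Real.sq_sqrt zero_le_two]
  have h1 := pow_le_pow_left₀ hω (le_max_left (omegaC μ CF L₁F L₂G) L₁G) 2
  have h2 := pow_le_pow_left₀ hL₁G (le_max_right (omegaC μ CF L₁F L₂G) L₁G) 2
  nlinarith [mul_le_mul_of_nonneg_right h1 (sq_nonneg a),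
    mul_le_mul_of_nonneg_right h2 (sq_nonneg b),
    sq_nonneg (L₁G * b - omegaC μ CF L₁F L₂G * a)]

end Constants

theorem one_add_le_mul {c x y D : ℝ} (hc : 0 ≤ c) (hx : 0 ≤ x) (hy : 0 ≤ y) (hD : D ≤ c * x) :
    1 + D ≤ (1 + c) * (1 + x + y) := by
  linarith [mul_nonneg hc hy]

/-- The Lyapunov function. -/
noncomputable def lyapunov {p d : ℕ} (F G : Vec p → Vec d → ℝ) (cz cv : ℝ) (s : State p d) : ℝ :=
  value F G s.2.2 + (cz * ‖s.1 - zStar G s.2.2‖ ^ 2 + cv * ‖s.2.1 - vStar F G s.2.2‖ ^ 2)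

/-! ### One-step descent of the Lyapunov function -/

section Descent

variable {p d : ℕ} {F G : Vec p → Vec d → ℝ} {μ CF : ℝ} {L₁F L₂F L₁G L₂G L₃G : ℝ≥0}

set_option maxHeartbeats 1000000 in
-- The constants do not depend on the state, on the weights or on $\rho$, so one choice serves the
-- whole trajectory. The second-order terms may grow like the squared errors, hence the factor
-- $\kappa-K\rho$; no a priori bound on the iterates is required.
theorem exists_lyapunov_descent (hF : OuterRegular F L₁F L₂F)
    (hG : InnerRegular G μ L₁G L₂G L₃G) (hμ : 0 < μ) (hCF : 0 < CF) (hL₁F : 0 < L₁F)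
    (hL₁G : 0 < L₁G) (hbd : ∀ x, ‖grad1 F (zStar G x) x‖ ≤ CF) {ξ : ℝ} (hξ : 0 < ξ)
    (hξmax : ξ ^ 2 ≤ xiSqMax μ CF L₁F L₁G L₂G) (Bz Bv Bx : ℝ) :
    ∃ cz cv κ K : ℝ, 0 ≤ cz ∧ 0 ≤ cv ∧ 0 < κ ∧ 0 ≤ K ∧
      ∀ {ι : Type} [Fintype ι] (q : ι → ℝ), (∀ u, 0 ≤ q u) → ∑ u, q u = 1 →
      ∀ (s : State p d) (Dz Dv : ι → Vec p) (Dx : ι → Vec d) (ρ : ℝ), 0 < ρ →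
      ∑ u, q u • Dz u = dirZ G s → ∑ u, q u • Dv u = dirV F G s →
      ∑ u, q u • Dx u = dirX F G s →
      ∑ u, q u * ‖Dz u‖ ^ 2 ≤ Bz ^ 2 * (1 + ‖dirZ G s‖ ^ 2) →
      ∑ u, q u * ‖Dv u‖ ^ 2 ≤ Bv ^ 2 * (1 + ‖dirV F G s‖ ^ 2) →
      ∑ u, q u * ‖Dx u‖ ^ 2 ≤ Bx ^ 2 →
      ∑ u, q u * lyapunov F G cz cv
          (s.1 - ρ • Dz u, s.2.1 - ρ • Dv u, s.2.2 - (ξ * ρ) • Dx u)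
        ≤ lyapunov F G cz cv s - ξ * ρ / 2 * ‖valueGrad F G s.2.2‖ ^ 2
          - ρ * (κ - K * ρ) * (‖s.1 - zStar G s.2.2‖ ^ 2 + ‖s.2.1 - vStar F G s.2.2‖ ^ 2)
          + K * ρ ^ 2 := by
  obtain ⟨Cz, hCz, hzexp⟩ := hG.quadExp_zStar hμ
  obtain ⟨Cv, hCv, hvexp⟩ := quadExp_vStar hF hG hμ hbd
  obtain ⟨Ch, hCh, hhexp⟩ := exists_value_expansion hF hG hμ hbd
  set ω := omegaC μ CF L₁F L₂G with hωdef
  set φz := phiZ μ CF L₁F L₁G L₂G with hφzdef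
  set φv := phiV μ CF L₁F L₁G L₂G with hφvdef
  set L := lStar μ CF L₁F L₁G L₂G with hLdef
  set Lx := lX μ CF L₁F L₁G L₂G with hLxdef
  have hω : 0 < ω := omegaC_pos hμ hCF (NNReal.coe_pos.2 hL₁F) L₂G.2
  have hφz : 0 < φz := phiZ_pos hμ (NNReal.coe_pos.2 hL₁G)
  have hφv : 0 < φv := phiV_pos hμ hCF (NNReal.coe_pos.2 hL₁F) (NNReal.coe_pos.2 hL₁G) L₂G.2
  have hL : 0 < L := lStar_pos hμ (NNReal.coe_pos.2 hL₁G)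
  have hLip : ∀ {f : Vec d → Vec p} {K : ℝ}, K ≤ L → (∀ x y, ‖f x - f y‖ ≤ K * ‖x - y‖) →
      LipschitzWith (Real.toNNReal L) f := fun hK h =>
    LipschitzWith.of_dist_le' fun x y => by
      rw [dist_eq_norm, dist_eq_norm]
      exact (h x y).trans (mul_le_mul_of_nonneg_right hK (norm_nonneg _))
  have hzLip : LipschitzWith (Real.toNNReal L) (zStar G) :=
    hLip (le_max_left _ _) (hG.norm_zStar_sub_le hμ)
  have hvLip : LipschitzWith (Real.toNNReal L) (vStar F G) :=
    hLip (le_max_right _ _) (norm_vStar_sub_le hF hG hμ hbd)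
  have hLnn : ((Real.toNNReal L : ℝ≥0) : ℝ) = L := Real.coe_toNNReal L hL.le
  set m := min (μ / 2 * φz) (μ / 2 * φv) with hm
  have hmpos : 0 < m := lt_min (by positivity) (by positivity)
  -- The $\rho^2$ coefficients: second moment of the direction, plus the Lipschitz and curvature
  -- contributions of the moving target.
  set Kz := 2 * Bz ^ 2 * (1 + (L₁G : ℝ) ^ 2) + (2 * L ^ 2 + Cz) * ξ ^ 2 * Bx ^ 2 with hKz
  set Kv := 2 * Bv ^ 2 * (1 + (2 * (L₁G : ℝ) ^ 2 + 2 * ω ^ 2)) + (2 * L ^ 2 + Cv) * ξ ^ 2 * Bx ^ 2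
    with hKv
  -- With weights $\phi/\xi$ the first-order terms are $\rho/\xi$ times the expression in
  -- `drift_le`.
  refine ⟨φz / ξ, φv / ξ, m / ξ, Ch * ξ ^ 2 * Bx ^ 2 + φz / ξ * Kz + φv / ξ * Kv,
    by positivity, by positivity, by positivity, by positivity, ?_⟩
  intro ι _ q hq hq1 s Dz Dv Dx ρ hρ hDz hDv hDx hMz hMv hMx
  obtain ⟨Jz, hJz⟩ := hzexp s.2.2
  obtain ⟨Jv, hJv⟩ := hvexp s.2.2
  have hγ : 0 ≤ ξ * ρ := by positivity
  have tz := sum_norm_sub_target_sq_le hq hq1 hzLip hJz s.1 Dz Dx (ρ := ρ) hγ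
  have tv := sum_norm_sub_target_sq_le hq hq1 hvLip hJv s.2.1 Dv Dx (ρ := ρ) hγ
  have th := sum_expansion_le hq hq1 (hhexp s.2.2) Dx (ξ * ρ)
  rw [hDz, hDx, hLnn] at tz
  rw [hDv, hDx, hLnn] at tv
  rw [hDx] at th
  have iz := inner_dirZ_ge hG hμ s
  have iv := inner_dirV_ge hF hG hμ hbd s
  have nz := norm_dirZ_le hG hμ s
  have nv := norm_dirV_le hF hG hμ hbd s
  have nx := norm_dirX_sub_le hF hG hμ hbd s
  -- Polarization supplies the term $-\|D_x\|^2$ that pays for the drift of both targets.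
  have hpol : 2 * inner ℝ (valueGrad F G s.2.2) (dirX F G s) = ‖valueGrad F G s.2.2‖ ^ 2
      + ‖dirX F G s‖ ^ 2 - ‖dirX F G s - valueGrad F G s.2.2‖ ^ 2 := by
    rw [norm_sub_sq_real, real_inner_comm]; ring
  simp only [lyapunov]
  have hsum : ∑ u, q u * (value F G (s.2.2 - (ξ * ρ) • Dx u)
      + (φz / ξ * ‖s.1 - ρ • Dz u - zStar G (s.2.2 - (ξ * ρ) • Dx u)‖ ^ 2
      + φv / ξ * ‖s.2.1 - ρ • Dv u - vStar F G (s.2.2 - (ξ * ρ) • Dx u)‖ ^ 2))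
      = ∑ u, q u * value F G (s.2.2 - (ξ * ρ) • Dx u)
      + (φz / ξ * ∑ u, q u * ‖s.1 - ρ • Dz u - zStar G (s.2.2 - (ξ * ρ) • Dx u)‖ ^ 2
      + φv / ξ * ∑ u, q u * ‖s.2.1 - ρ • Dv u - vStar F G (s.2.2 - (ξ * ρ) • Dx u)‖ ^ 2) := by
    rw [Finset.mul_sum, Finset.mul_sum, ← Finset.sum_add_distrib, ← Finset.sum_add_distrib]
    exact Finset.sum_congr rfl fun u _ => by ring
  rw [hsum]
  clear hsum
  have hMx0 : 0 ≤ ∑ u, q u * ‖Dx u‖ ^ 2 :=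
    Finset.sum_nonneg fun u _ => mul_nonneg (hq u) (by positivity)
  -- From here on only a real inequality in the error norms, the direction norms and the averages is
  -- left.
  generalize ∑ u, q u * value F G (s.2.2 - (ξ * ρ) • Dx u) = Sh at th ⊢
  generalize ∑ u, q u * ‖s.1 - ρ • Dz u - zStar G (s.2.2 - (ξ * ρ) • Dx u)‖ ^ 2 = Sz at tz ⊢
  generalize ∑ u, q u * ‖s.2.1 - ρ • Dv u - vStar F G (s.2.2 - (ξ * ρ) • Dx u)‖ ^ 2 = Sv at tv ⊢
  generalize ∑ u, q u * ‖Dx u‖ ^ 2 = Mx at th tz tv hMx hMx0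
  generalize ∑ u, q u * ‖Dz u‖ ^ 2 = Mz at tz hMz
  generalize ∑ u, q u * ‖Dv u‖ ^ 2 = Mv at tv hMv
  have ha : 0 ≤ ‖s.1 - zStar G s.2.2‖ := norm_nonneg _
  have hb : 0 ≤ ‖s.2.1 - vStar F G s.2.2‖ := norm_nonneg _
  generalize inner ℝ (s.1 - zStar G s.2.2) (dirZ G s) = Iz at tz iz
  generalize inner ℝ (s.2.1 - vStar F G s.2.2) (dirV F G s) = Iv at tv iv
  generalize inner ℝ (valueGrad F G s.2.2) (dirX F G s) = Ix at th hpol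
  have hnz : 0 ≤ ‖dirZ G s‖ := norm_nonneg _
  have hnv : 0 ≤ ‖dirV F G s‖ := norm_nonneg _
  have hnx : 0 ≤ ‖dirX F G s - valueGrad F G s.2.2‖ := norm_nonneg _
  generalize ‖s.1 - zStar G s.2.2‖ = a at *
  generalize ‖s.2.1 - vStar F G s.2.2‖ = b at *
  generalize ‖dirX F G s‖ = N at *
  generalize ‖dirX F G s - valueGrad F G s.2.2‖ = R at *
  generalize ‖valueGrad F G s.2.2‖ = g at *
  generalize value F G s.2.2 = h0 at *
  generalize ‖dirZ G s‖ = dz at *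
  generalize ‖dirV F G s‖ = dv at *
  have hR : R ^ 2 ≤ Lx ^ 2 * (a ^ 2 + b ^ 2) :=
    (pow_le_pow_left₀ hnx nx 2).trans (sq_le_lX_sq_mul hω.le L₁G.2 a b)
  have hξ2 := sq_mul_lX_sq_le (NNReal.coe_pos.2 hL₁G) hξmax
  have hdrift := drift_le (a := a) (b := b) (N := N) (L := L) (ω := ω) (ξ := ξ) (Lx := Lx) hμ
    hφz.le hφv.le
    (phiZ_mul_lStar_sq hμ (NNReal.coe_pos.2 hL₁G)).le
    (phiV_mul_lStar_sq_le hμ (NNReal.coe_pos.2 hL₁G))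
    (phiV_mul_omegaC_sq_le hμ hCF (NNReal.coe_pos.2 hL₁F) L₂G.2)
    (hξ2.trans (mul_le_mul_of_nonneg_left (min_le_right _ _) hμ.le))
    (hξ2.trans (mul_le_mul_of_nonneg_left (min_le_left _ _) hμ.le))
  have hm1 : m * (a ^ 2 + b ^ 2) ≤ μ / 2 * φz * a ^ 2 + μ / 2 * φv * b ^ 2 := by
    rw [mul_add]
    exact add_le_add (mul_le_mul_of_nonneg_right (min_le_left _ _) (sq_nonneg a))
      (mul_le_mul_of_nonneg_right (min_le_right _ _) (sq_nonneg b))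
  have hMz' : 2 * Mz ≤ 2 * Bz ^ 2 * (1 + (L₁G : ℝ) ^ 2) * (1 + a ^ 2 + b ^ 2) := by
    have h1 : dz ^ 2 ≤ (L₁G : ℝ) ^ 2 * a ^ 2 := by
      rw [← mul_pow]; exact pow_le_pow_left₀ hnz nz 2
    have h2 := one_add_le_mul (sq_nonneg (L₁G : ℝ)) (sq_nonneg a) (sq_nonneg b) h1
    calc _ ≤ 2 * (Bz ^ 2 * ((1 + (L₁G : ℝ) ^ 2) * (1 + a ^ 2 + b ^ 2))) := by
          gcongr; exact hMz.trans (mul_le_mul_of_nonneg_left h2 (sq_nonneg Bz))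
      _ = _ := by ring
  have hMv' : 2 * Mv ≤ 2 * Bv ^ 2 * (1 + (2 * (L₁G : ℝ) ^ 2 + 2 * ω ^ 2)) * (1 + a ^ 2 + b ^ 2) := by
    have h1 : dv ^ 2 ≤ (2 * (L₁G : ℝ) ^ 2 + 2 * ω ^ 2) * (a ^ 2 + b ^ 2) := by
      refine (pow_le_pow_left₀ hnv nv 2).trans ?_
      linarith [sq_nonneg (L₁G * b - ω * a), mul_nonneg (sq_nonneg (L₁G : ℝ)) (sq_nonneg a),
        mul_nonneg (sq_nonneg ω) (sq_nonneg b)]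
    have h2 := one_add_le_mul (by positivity) (by positivity) le_rfl h1
    rw [add_zero, ← add_assoc 1 (a ^ 2)] at h2
    calc _ ≤ 2 * (Bv ^ 2 * ((1 + (2 * (L₁G : ℝ) ^ 2 + 2 * ω ^ 2)) * (1 + a ^ 2 + b ^ 2))) := by
          gcongr; exact hMv.trans (mul_le_mul_of_nonneg_left h2 (sq_nonneg Bv))
      _ = _ := by ring
  have hsec : ∀ C c : ℝ, 0 ≤ C → 0 ≤ c → c ^ 2 ≤ a ^ 2 + b ^ 2 →
      (2 * L ^ 2 + 2 * C * c) * (ξ * ρ) ^ 2 * Mx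
        ≤ (2 * L ^ 2 + C) * ξ ^ 2 * Bx ^ 2 * (1 + a ^ 2 + b ^ 2) * ρ ^ 2 := by
    intro C c hC hc hcab
    have h1 : 2 * L ^ 2 + 2 * C * c ≤ (2 * L ^ 2 + C) * (1 + a ^ 2 + b ^ 2) := by
      -- The curvature term is linear in the tracking error; $2c\le1+c^2$ fits it into the common
      -- factor $1+a^2+b^2$.
      have h2 : 2 * c ≤ 1 + a ^ 2 + b ^ 2 := by linarith [sq_nonneg (c - 1)]
      linarith [mul_le_mul_of_nonneg_left h2 hC, mul_nonneg (sq_nonneg L) (sq_nonneg a),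
        mul_nonneg (sq_nonneg L) (sq_nonneg b)]
    calc _ ≤ ((2 * L ^ 2 + C) * (1 + a ^ 2 + b ^ 2)) * (ξ * ρ) ^ 2 * Bx ^ 2 := by gcongr
      _ = _ := by ring
  have hz2 := hsec Cz a hCz ha (by linarith [sq_nonneg b])
  have hv2 := hsec Cv b hCv hb (by linarith [sq_nonneg a])
  have hh2 : Ch * (ξ * ρ) ^ 2 * Mx ≤ Ch * ξ ^ 2 * Bx ^ 2 * (1 + a ^ 2 + b ^ 2) * ρ ^ 2 := by
    calc _ ≤ Ch * (ξ * ρ) ^ 2 * Bx ^ 2 := by gcongr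
      _ = Ch * ξ ^ 2 * Bx ^ 2 * 1 * ρ ^ 2 := by ring
      _ ≤ _ := by
        gcongr
        linarith [sq_nonneg a, sq_nonneg b]
  have tz' : Sz ≤ a ^ 2 + ρ * (-2 * (μ * a ^ 2) + 2 * ξ * L * a * N)
      + Kz * (1 + a ^ 2 + b ^ 2) * ρ ^ 2 := by
    have h1 := mul_le_mul_of_nonneg_right hMz' (sq_nonneg ρ)
    have h2 := mul_le_mul_of_nonneg_left iz hρ.le
    rw [hKz]; linarith
  have tv' : Sv ≤ b ^ 2 + ρ * (-2 * (μ * b ^ 2 - ω * a * b) + 2 * ξ * L * b * N)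
      + Kv * (1 + a ^ 2 + b ^ 2) * ρ ^ 2 := by
    have h1 := mul_le_mul_of_nonneg_right hMv' (sq_nonneg ρ)
    have h2 := mul_le_mul_of_nonneg_left iv hρ.le
    rw [hKv]; linarith
  have th' : Sh ≤ h0 - ξ * ρ / 2 * g ^ 2 + ξ * ρ / 2 * (Lx ^ 2 * (a ^ 2 + b ^ 2) - N ^ 2)
      + Ch * ξ ^ 2 * Bx ^ 2 * (1 + a ^ 2 + b ^ 2) * ρ ^ 2 := by
    have h1 := mul_le_mul_of_nonneg_left hR hγ
    have h2 : ξ * ρ * Ix = ξ * ρ / 2 * (g ^ 2 + N ^ 2 - R ^ 2) := by rw [← hpol]; ring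
    linarith
  have tz'' := mul_le_mul_of_nonneg_left tz' (by positivity : 0 ≤ φz / ξ)
  have tv'' := mul_le_mul_of_nonneg_left tv' (by positivity : 0 ≤ φv / ξ)
  have hd' : ξ * ρ / 2 * (Lx ^ 2 * (a ^ 2 + b ^ 2) - N ^ 2)
      + φz / ξ * (ρ * (-2 * (μ * a ^ 2) + 2 * ξ * L * a * N))
      + φv / ξ * (ρ * (-2 * (μ * b ^ 2 - ω * a * b) + 2 * ξ * L * b * N))
      ≤ -(ρ * (m / ξ) * (a ^ 2 + b ^ 2)) := by
    have h1 := mul_le_mul_of_nonneg_left (hdrift.trans (neg_le_neg hm1))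
      (by positivity : 0 ≤ ρ / ξ)
    have h2 : ρ / ξ * (ξ ^ 2 / 2 * (Lx ^ 2 * (a ^ 2 + b ^ 2) - N ^ 2)
      + φz * (-2 * (μ * a ^ 2) + 2 * ξ * L * a * N)
      + φv * (-2 * (μ * b ^ 2 - ω * a * b) + 2 * ξ * L * b * N))
      = ξ * ρ / 2 * (Lx ^ 2 * (a ^ 2 + b ^ 2) - N ^ 2)
      + φz / ξ * (ρ * (-2 * (μ * a ^ 2) + 2 * ξ * L * a * N))
      + φv / ξ * (ρ * (-2 * (μ * b ^ 2 - ω * a * b) + 2 * ξ * L * b * N)) := by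
      field_simp
    have h3 : ρ / ξ * -(m * (a ^ 2 + b ^ 2)) = -(ρ * (m / ξ) * (a ^ 2 + b ^ 2)) := by ring
    rw [← h2, ← h3]
    exact h1
  linarith

end Descent

/-! ### The sampled directions are unbiased -/

section Mean

variable {n m p d : ℕ}

theorem hasGradientAt_joint_mean {Φ : Fin n → Vec p → Vec d → ℝ}
    (h : ∀ i, Differentiable ℝ (joint (Φ i))) (w : WithLp 2 (Vec p × Vec d)) :
    HasGradientAt (joint (mean Φ)) ((1 / (n : ℝ)) • ∑ i, gradient (joint (Φ i)) w) w := by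
  rw [hasGradientAt_iff_hasFDerivAt, map_smul, map_sum]
  have h1 : HasFDerivAt (fun w => ∑ i, joint (Φ i) w)
      (∑ i, InnerProductSpace.toDual ℝ _ (gradient (joint (Φ i)) w)) w :=
    HasFDerivAt.fun_sum fun i _ => (h i w).hasGradientAt.hasFDerivAt
  exact h1.const_mul (1 / (n : ℝ))

theorem differentiable_joint_mean {Φ : Fin n → Vec p → Vec d → ℝ}
    (h : ∀ i, Differentiable ℝ (joint (Φ i))) : Differentiable ℝ (joint (mean Φ)) :=
  fun w => (hasGradientAt_joint_mean h w).differentiableAt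

theorem gradient_joint_mean {Φ : Fin n → Vec p → Vec d → ℝ}
    (h : ∀ i, Differentiable ℝ (joint (Φ i))) :
    gradient (joint (mean Φ)) = fun w => (1 / (n : ℝ)) • ∑ i, gradient (joint (Φ i)) w :=
  funext fun w => (hasGradientAt_joint_mean h w).gradient

theorem fderiv_smul_sum_apply {E H : Type*} [NormedAddCommGroup E] [NormedSpace ℝ E]
    [NormedAddCommGroup H] [NormedSpace ℝ H] (c : ℝ) {f : Fin n → E → H}
    (hf : ∀ i, Differentiable ℝ (f i)) (w u : E) :
    fderiv ℝ (fun w => c • ∑ i, f i w) w u = c • ∑ i, fderiv ℝ (f i) w u := by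
  have h : HasFDerivAt (fun w => c • ∑ i, f i w) (c • ∑ i, fderiv ℝ (f i) w) w :=
    (HasFDerivAt.fun_sum fun i _ => (hf i w).hasFDerivAt).const_smul c
  rw [h.fderiv, smul_apply, sum_apply]

theorem differentiable_gradient_joint_mean {Φ : Fin n → Vec p → Vec d → ℝ}
    (h : ∀ i, Differentiable ℝ (joint (Φ i)))
    (h' : ∀ i, Differentiable ℝ (gradient (joint (Φ i)))) :
    Differentiable ℝ (gradient (joint (mean Φ))) := by
  rw [gradient_joint_mean h]
  exact (Differentiable.fun_sum fun i _ => h' i).fun_const_smul (1 / (n : ℝ))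

theorem fderiv_gradient_joint_mean_apply {Φ : Fin n → Vec p → Vec d → ℝ}
    (h : ∀ i, Differentiable ℝ (joint (Φ i))) (h' : ∀ i, Differentiable ℝ (gradient (joint (Φ i))))
    (w u : WithLp 2 (Vec p × Vec d)) :
    fderiv ℝ (gradient (joint (mean Φ))) w u
      = (1 / (n : ℝ)) • ∑ i, fderiv ℝ (gradient (joint (Φ i))) w u := by
  rw [gradient_joint_mean h]
  exact fderiv_smul_sum_apply _ h' w u

theorem fst_smul_sum (c : ℝ) (w : Fin n → WithLp 2 (Vec p × Vec d)) :
    (c • ∑ i, w i).fst = c • ∑ i, (w i).fst := by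
  have h := map_sum (WithLp.fstL 2 ℝ (Vec p) (Vec d)) w Finset.univ
  rw [WithLp.smul_fst]
  exact congrArg (c • ·) h

theorem snd_smul_sum (c : ℝ) (w : Fin n → WithLp 2 (Vec p × Vec d)) :
    (c • ∑ i, w i).snd = c • ∑ i, (w i).snd := by
  have h := map_sum (WithLp.sndL 2 ℝ (Vec p) (Vec d)) w Finset.univ
  rw [WithLp.smul_snd]
  exact congrArg (c • ·) h

theorem grad1_mean {Φ : Fin n → Vec p → Vec d → ℝ} (h : ∀ i, Differentiable ℝ (joint (Φ i)))
    (z : Vec p) (x : Vec d) : grad1 (mean Φ) z x = (1 / (n : ℝ)) • ∑ i, grad1 (Φ i) z x := by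
  rw [grad1_eq (differentiable_joint_mean h), gradient_joint_mean h, fst_smul_sum]
  simp only [grad1_eq (h _)]

theorem grad2_mean {Φ : Fin n → Vec p → Vec d → ℝ} (h : ∀ i, Differentiable ℝ (joint (Φ i)))
    (z : Vec p) (x : Vec d) : grad2 (mean Φ) z x = (1 / (n : ℝ)) • ∑ i, grad2 (Φ i) z x := by
  rw [grad2_eq (differentiable_joint_mean h), gradient_joint_mean h, snd_smul_sum]
  simp only [grad2_eq (h _)]

theorem hess11_mean_apply {Φ : Fin n → Vec p → Vec d → ℝ}
    (h : ∀ i, Differentiable ℝ (joint (Φ i))) (h' : ∀ i, Differentiable ℝ (gradient (joint (Φ i))))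
    (z : Vec p) (x : Vec d) (v : Vec p) :
    hess11 (mean Φ) z x v = (1 / (n : ℝ)) • ∑ i, hess11 (Φ i) z x v := by
  rw [hess11_apply (differentiable_joint_mean h) (differentiable_gradient_joint_mean h h'),
    fderiv_gradient_joint_mean_apply h h', fst_smul_sum]
  simp only [hess11_apply (h _) (h' _)]

theorem hess21_mean_apply {Φ : Fin n → Vec p → Vec d → ℝ}
    (h : ∀ i, Differentiable ℝ (joint (Φ i))) (h' : ∀ i, Differentiable ℝ (gradient (joint (Φ i))))
    (z : Vec p) (x : Vec d) (v : Vec p) :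
    hess21 (mean Φ) z x v = (1 / (n : ℝ)) • ∑ i, hess21 (Φ i) z x v := by
  rw [hess21_apply (differentiable_joint_mean h) (differentiable_gradient_joint_mean h h'),
    fderiv_gradient_joint_mean_apply h h', snd_smul_sum]
  simp only [hess21_apply (h _) (h' _)]

theorem sum_prod_smul_add {E : Type*} [AddCommGroup E] [Module ℝ E] (hn : n ≠ 0) (hm : m ≠ 0)
    (a : Fin n → E) (b : Fin m → E) :
    ∑ u : Fin n × Fin m, (1 / (n : ℝ) * (1 / (m : ℝ))) • (a u.1 + b u.2)
      = (1 / (n : ℝ)) • ∑ i, a i + (1 / (m : ℝ)) • ∑ j, b j := by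
  have hn' : (n : ℝ) ≠ 0 := Nat.cast_ne_zero.2 hn
  have hm' : (m : ℝ) ≠ 0 := Nat.cast_ne_zero.2 hm
  rw [← Finset.smul_sum, Fintype.sum_prod_type]
  simp only [Finset.sum_add_distrib, Finset.sum_const, Finset.card_univ, Fintype.card_fin,
    ← Finset.smul_sum, ← Nat.cast_smul_eq_nsmul ℝ, smul_add, smul_smul]
  congr 2 <;> field_simp

variable {F : Fin m → Vec p → Vec d → ℝ} {G : Fin n → Vec p → Vec d → ℝ}
  (hF : ∀ j, Differentiable ℝ (joint (F j))) (hG : ∀ i, Differentiable ℝ (joint (G i)))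
  (hG' : ∀ i, Differentiable ℝ (gradient (joint (G i)))) (hn : n ≠ 0) (hm : m ≠ 0)
include hG hn hm

theorem sum_smul_dirZ (s : State p d) :
    ∑ u : Fin n × Fin m, (1 / (n : ℝ) * (1 / (m : ℝ))) • dirZ (G u.1) s = dirZ (mean G) s := by
  have := sum_prod_smul_add hn hm (fun i => dirZ (G i) s) (fun _ : Fin m => 0)
  simp only [add_zero, Finset.sum_const_zero, smul_zero] at this
  rw [this, dirZ, grad1_mean hG]
  rfl

include hF hG'

theorem sum_smul_dirV (s : State p d) :
    ∑ u : Fin n × Fin m, (1 / (n : ℝ) * (1 / (m : ℝ))) • dirV (F u.2) (G u.1) s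
      = dirV (mean F) (mean G) s := by
  rw [dirV, grad1_mean hF, hess11_mean_apply hG hG']
  exact sum_prod_smul_add hn hm (fun i => hess11 (G i) s.1 s.2.2 s.2.1)
    (fun j => grad1 (F j) s.1 s.2.2)

theorem sum_smul_dirX (s : State p d) :
    ∑ u : Fin n × Fin m, (1 / (n : ℝ) * (1 / (m : ℝ))) • dirX (F u.2) (G u.1) s
      = dirX (mean F) (mean G) s := by
  rw [dirX, grad2_mean hF, hess21_mean_apply hG hG']
  exact sum_prod_smul_add hn hm (fun i => hess21 (G i) s.1 s.2.2 s.2.1)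
    (fun j => grad2 (F j) s.1 s.2.2)

end Mean

/-! ### Finitely valued random variables -/

section Finite

variable {Ω : Type*} [MeasurableSpace Ω] {P : Measure Ω} [IsProbabilityMeasure P]
  {α β T : Type*} [MeasurableSpace α] [Finite α] [MeasurableSingletonClass α]
  [MeasurableSpace β] [Fintype β] [MeasurableSingletonClass β]
  [MeasurableSpace T] [MeasurableSingletonClass T]

omit [MeasurableSpace Ω] in
-- On a finite range every function is measurable, so nothing about the measurability of the
-- individual $F_j,G_i$ or their derivatives is needed.
theorem measurable_comap_of_finite_range {S : Ω → T} (hS : (Set.range S).Finite) (g : T → ℝ) :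
    Measurable[MeasurableSpace.comap S inferInstance] (g ∘ S) := by
  intro A _
  refine ⟨g ⁻¹' A ∩ Set.range S, (hS.subset Set.inter_subset_right).measurableSet, ?_⟩
  ext ω; simp

theorem integrable_comp_of_finite {Y : Ω → α} (hY : Measurable Y) (g : α → ℝ) :
    Integrable (fun ω => g (Y ω)) P := by
  have : IsProbabilityMeasure (P.map Y) := Measure.isProbabilityMeasure_map hY.aemeasurable
  exact (Integrable.of_finite (μ := P.map Y) (f := g)).comp_measurable hY

variable {Y : Ω → α} {U : Ω → β} {Φ : α → T} {S : Ω → T}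

/-- Decompose over the values of $U$: the factor depending on $S$ is pulled out, and the independent
indicator of $\{U=u\}$ averages to its probability. -/
theorem condExp_comp_indep (hY : Measurable Y) (hU : Measurable U) (hind : IndepFun U Y P)
    (hS : ∀ ω, S ω = Φ (Y ω)) (f : β → T → ℝ) :
    P[fun ω => f (U ω) (S ω) | MeasurableSpace.comap S inferInstance]
      =ᵐ[P] fun ω => ∑ u, P.real {ω | U ω = u} * f u (S ω) := by
  classical
  have hSY : S = Φ ∘ Y := funext hS
  have hΦ : Measurable Φ := measurable_of_finite Φ
  have hSm : Measurable S := hSY ▸ hΦ.comp hY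
  have hfin : (Set.range S).Finite := by
    rw [hSY]; exact (Set.finite_range Φ).subset (Set.range_comp_subset_range _ _)
  have hindS : IndepFun U S P := hSY ▸ hind.comp measurable_id hΦ
  let I : β → Ω → ℝ := fun u ω => if U ω = u then 1 else 0
  have hI : ∀ u, Measurable[MeasurableSpace.comap U inferInstance] (I u) := fun u =>
    (measurable_of_finite fun b : β => if b = u then (1 : ℝ) else 0).comp (comap_measurable U)
  have hIint : ∀ u, Integrable (I u) P := fun u =>
    integrable_comp_of_finite hU fun b : β => if b = u then (1 : ℝ) else 0
  have hprod : ∀ u, Integrable ((f u ∘ S) * I u) P := fun u => by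
    have h := integrable_comp_of_finite (P := P) (hU.prodMk hY)
      fun c : β × α => f u (Φ c.2) * if c.1 = u then (1 : ℝ) else 0
    rw [hSY]; exact h
  have hdecomp : (fun ω => f (U ω) (S ω)) = ∑ u, (f u ∘ S) * I u := by
    funext ω
    simp [I]
  rw [hdecomp]
  have h1 := condExp_finsetSum (μ := P) (s := Finset.univ) (f := fun u => (f u ∘ S) * I u)
    (fun u _ => hprod u) (MeasurableSpace.comap S inferInstance)
  have h2 : ∀ u, P[(f u ∘ S) * I u | MeasurableSpace.comap S inferInstance]
      =ᵐ[P] fun ω => P.real {ω | U ω = u} * f u (S ω) := fun u => by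
    have h3 := condExp_mul_of_stronglyMeasurable_left (μ := P)
      (measurable_comap_of_finite_range hfin (f u)).stronglyMeasurable (hprod u) (hIint u)
    have h4 := condExp_indep_eq (μ := P) hU.comap_le hSm.comap_le (hI u).stronglyMeasurable hindS
    have h5 : ∫ ω, I u ω ∂P = P.real {ω | U ω = u} := by
      have : I u = Set.indicator {ω | U ω = u} 1 := by
        funext ω; simp [I, Set.indicator_apply]
      have hm : MeasurableSet {ω | U ω = u} := hU (measurableSet_singleton u)
      rw [this, integral_indicator_one hm]
    filter_upwards [h3, h4] with ω h3 h4
    rw [h3, Pi.mul_apply, h4, h5, mul_comm, Function.comp_apply]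
  filter_upwards [h1, ae_all_iff.2 h2] with ω h1 h2
  rw [h1, Finset.sum_apply]
  exact Finset.sum_congr rfl fun u _ => h2 u

theorem integral_comp_indep (hY : Measurable Y) (hU : Measurable U) (hind : IndepFun U Y P)
    (hS : ∀ ω, S ω = Φ (Y ω)) (f : β → T → ℝ) :
    ∫ ω, f (U ω) (S ω) ∂P = ∫ ω, ∑ u, P.real {ω | U ω = u} * f u (S ω) ∂P := by
  have hSm : Measurable S := (funext hS : S = Φ ∘ Y) ▸ (measurable_of_finite Φ).comp hY
  rw [← integral_condExp hSm.comap_le]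
  exact integral_congr_ae (condExp_comp_indep hY hU hind hS f)

end Finite

/-! ### The iterates -/

section Iterates

variable {n m p d : ℕ} {Ω : Type*} [MeasurableSpace Ω] {P : Measure Ω}
  {i : ℕ → Ω → Fin n} {j : ℕ → Ω → Fin m}

theorem IsUniformSampling.real_pair (h : IsUniformSampling P i j) (t : ℕ) (u : Fin n × Fin m) :
    P.real {ω | (i t ω, j t ω) = u} = 1 / (n : ℝ) * (1 / (m : ℝ)) := by
  have h1 := (h.indep_pair t).measure_inter_preimage_eq_mul {u.1} {u.2}
    (measurableSet_singleton _) (measurableSet_singleton _)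
  have h2 : {ω | (i t ω, j t ω) = u} = i t ⁻¹' {u.1} ∩ j t ⁻¹' {u.2} := by
    ext ω; simp [Prod.ext_iff]
  rw [h2, Measure.real, h1, ENNReal.toReal_mul]
  exact congrArg₂ _ (h.uniform_i t u.1) (h.uniform_j t u.2)

theorem IsUniformSampling.measurable_pair (h : IsUniformSampling P i j) (t : ℕ) :
    Measurable fun ω => (i t ω, j t ω) := (h.measurable_i t).prodMk (h.measurable_j t)

/-- The indices sampled before step `t`. -/
def past (i : ℕ → Ω → Fin n) (j : ℕ → Ω → Fin m) (t : ℕ) (ω : Ω) :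
    Finset.range t → Fin n × Fin m := fun k => (i k ω, j k ω)

theorem IsUniformSampling.measurable_past (h : IsUniformSampling P i j) (t : ℕ) :
    Measurable (past i j t) := measurable_pi_lambda _ fun k => h.measurable_pair k

theorem IsUniformSampling.indepFun_past (h : IsUniformSampling P i j) (t : ℕ) :
    IndepFun (fun ω => (i t ω, j t ω)) (past i j t) P := by
  have h1 := h.indep_time.indepFun_finset {t} (Finset.range t) (by simp)
    (fun t => h.measurable_pair t)
  exact h1.comp (φ := fun c : ({t} : Finset ℕ) → Fin n × Fin m => c ⟨t, by simp⟩)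
    (measurable_pi_apply _) measurable_id

variable (F : Fin m → Vec p → Vec d → ℝ) (G : Fin n → Vec p → Vec d → ℝ) (ρ γ : ℕ → ℝ)
  (s₁ : State p d)

theorem iterate_succ {t : ℕ} (ht : 1 ≤ t) (i : ℕ → Fin n) (j : ℕ → Fin m) :
    iterate F G ρ γ s₁ i j (t + 1)
      = step (F (j t)) (G (i t)) (ρ t) (γ t) (iterate F G ρ γ s₁ i j t) := by
  obtain ⟨t, rfl⟩ := Nat.exists_eq_add_of_le' ht
  rfl

omit [MeasurableSpace Ω] in
-- Factoring the iterate through the finitely valued past gives both its finite range and its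
-- independence from the indices drawn at step $t$.
theorem exists_iterate_eq_past (t : ℕ) : ∃ Φ : (Finset.range t → Fin n × Fin m) → State p d,
    ∀ (ω : Ω), iterate F G ρ γ s₁ (fun k => i k ω) (fun k => j k ω) t = Φ (past i j t ω) := by
  induction t with
  | zero => exact ⟨fun _ => s₁, fun ω => rfl⟩
  | succ t ih =>
    obtain ⟨Φ, hΦ⟩ := ih
    -- The passage from time $0$ to time $1$ is not a step: both values are $s_1$, and the index
    -- pair at time $0$ is never used.
    rcases Nat.eq_zero_or_pos t with rfl | ht
    · exact ⟨fun _ => s₁, fun ω => rfl⟩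
    · refine ⟨fun c => step (F (c ⟨t, by simp⟩).2) (G (c ⟨t, by simp⟩).1) (ρ t) (γ t)
        (Φ fun k => c ⟨k, by have := Finset.mem_range.1 k.2; simp; omega⟩), fun ω => ?_⟩
      rw [iterate_succ _ _ _ _ _ ht, hΦ]
      rfl

end Iterates

/-! ### From descent to the rate -/

theorem sum_Ico_inv_le_one_add_log {t₀ : ℕ} (ht₀ : 1 ≤ t₀) (T : ℕ) :
    ∑ t ∈ Finset.Ico t₀ (T + 1), (t : ℝ)⁻¹ ≤ 1 + Real.log T := by
  have h1 := harmonic_le_one_add_log T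
  rw [harmonic_eq_sum_Icc] at h1
  push_cast at h1
  refine le_trans (Finset.sum_le_sum_of_subset_of_nonneg (fun t ht => ?_) fun t _ _ => by positivity)
    h1
  rw [Finset.mem_Ico] at ht
  exact Finset.mem_Icc.2 ⟨ht₀.trans ht.1, Nat.lt_succ_iff.1 ht.2⟩

/-- A descent inequality with steps `ρ̄ t^(-1/2)` gives the rate `log T / √T` for the best
iterate. -/
theorem isBigO_iInf_of_descent {v g : ℕ → ℝ} {lo c K ρbar : ℝ} {t₀ : ℕ} (hρbar : 0 < ρbar)
    (hc : 0 < c) (hK : 0 ≤ K) (ht₀ : 1 ≤ t₀) (hlo : ∀ t, lo ≤ v t) (hg : ∀ t, 0 ≤ g t)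
    (hdesc : ∀ t, t₀ ≤ t → v (t + 1) ≤ v t - c * (ρbar * (t : ℝ) ^ (-(1 / 2) : ℝ)) * g t
      + K * (ρbar * (t : ℝ) ^ (-(1 / 2) : ℝ)) ^ 2) :
    (fun T : ℕ => ⨅ t : Set.Icc 1 T, g t)
      =O[atTop] fun T : ℕ => Real.log T * (T : ℝ) ^ (-(1 / 2) : ℝ) := by
  have hsq : ∀ t : ℕ, ((t : ℝ) ^ (-(1 / 2) : ℝ)) ^ 2 = (t : ℝ)⁻¹ := fun t => by
    rw [← Real.rpow_natCast, ← Real.rpow_mul t.cast_nonneg, ← Real.rpow_neg_one]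
    norm_num
  have hsum : ∀ N, t₀ ≤ N → c * ρbar * ∑ t ∈ Finset.Ico t₀ N, (t : ℝ) ^ (-(1 / 2) : ℝ) * g t
      ≤ v t₀ - v N + K * ρbar ^ 2 * ∑ t ∈ Finset.Ico t₀ N, (t : ℝ)⁻¹ := by
    intro N hN
    induction N, hN using Nat.le_induction with
    | base => simp
    | succ N hN ih =>
      have h1 := hdesc N hN
      rw [mul_pow, hsq] at h1
      rw [Finset.sum_Ico_succ_top hN, Finset.sum_Ico_succ_top hN]
      linarith
  -- The outer $2$ reflects a window of at least $T/2$ terms, the inner $2$ the bound $1+\log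
  -- T\le2\log T$.
  refine IsBigO.of_bound (2 / (c * ρbar) * (|v t₀ - lo| + 2 * (K * ρbar ^ 2))) ?_
  have hlog : ∀ᶠ T : ℕ in atTop, 1 ≤ Real.log T :=
    (Real.tendsto_log_atTop.comp tendsto_natCast_atTop_atTop).eventually_ge_atTop 1
  -- $T\ge2t_0$ ensures that at least $T/2$ indices lie between $t_0$ and $T$.
  filter_upwards [hlog, eventually_ge_atTop (2 * t₀)] with T hT1 hT
  have hTpos : 0 < (T : ℝ) := by exact_mod_cast (by omega : 0 < T)
  set I := ⨅ t : Set.Icc 1 T, g t with hI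
  have hI0 : 0 ≤ I := Real.iInf_nonneg fun t => hg t
  have hIle : ∀ t ∈ Finset.Ico t₀ (T + 1), I ≤ g t := fun t ht => by
    rw [Finset.mem_Ico] at ht
    exact ciInf_le ⟨0, by rintro _ ⟨t, rfl⟩; exact hg t⟩
      (⟨t, ht₀.trans ht.1, Nat.lt_succ_iff.1 ht.2⟩ : Set.Icc 1 T)
  set r := (T : ℝ) ^ (-(1 / 2) : ℝ) with hr
  have hr0 : 0 < r := Real.rpow_pos_of_pos hTpos _
  -- With $r=T^{-1/2}$, the lower bound $\frac T2rI$ on the weighted sum becomes a bound on $I$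
  -- after multiplication by $r$.
  have hrT : r * (T * r) = 1 := by
    have h := hsq T
    rw [← hr] at h
    rw [mul_left_comm, ← sq, h, mul_inv_cancel₀ hTpos.ne']
  have hlow : (T : ℝ) / 2 * (r * I) ≤ ∑ t ∈ Finset.Ico t₀ (T + 1), (t : ℝ) ^ (-(1 / 2) : ℝ) * g t := by
    have h1 : ∀ t ∈ Finset.Ico t₀ (T + 1), r * I ≤ (t : ℝ) ^ (-(1 / 2) : ℝ) * g t := fun t ht => by
      have ht' := Finset.mem_Ico.1 ht
      refine mul_le_mul ?_ (hIle t ht) hI0 (by positivity)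
      exact Real.rpow_le_rpow_of_nonpos (by exact_mod_cast (by omega : 0 < t))
        (by exact_mod_cast (by omega : t ≤ T)) (by norm_num)
    have h2 := Finset.card_nsmul_le_sum _ _ _ h1
    rw [Nat.card_Ico, nsmul_eq_mul] at h2
    refine le_trans (mul_le_mul_of_nonneg_right ?_ (by positivity)) h2
    rw [div_le_iff₀ two_pos]
    exact_mod_cast (by omega : T ≤ (T + 1 - t₀) * 2)
  have h1 := hsum (T + 1) (by omega)
  have h2 := sum_Ico_inv_le_one_add_log ht₀ T
  have h3 := hlo (T + 1)
  have h4 : c * ρbar * ((T : ℝ) / 2 * (r * I)) ≤ (|v t₀ - lo| + 2 * (K * ρbar ^ 2)) * Real.log T := by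
    have h5 := mul_le_mul_of_nonneg_left hlow (by positivity : 0 ≤ c * ρbar)
    have h6 := mul_le_mul_of_nonneg_left (h2.trans (by linarith : 1 + Real.log T ≤ 2 * Real.log T))
      (by positivity : 0 ≤ K * ρbar ^ 2)
    have h7 : v t₀ - lo ≤ |v t₀ - lo| * Real.log T :=
      (le_abs_self _).trans (le_mul_of_one_le_right (abs_nonneg _) hT1)
    linarith
  rw [Real.norm_of_nonneg hI0, Real.norm_of_nonneg (by positivity)]
  have h5 : I = 2 / (c * ρbar) * (c * ρbar * ((T : ℝ) / 2 * (r * I))) * r := by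
    have : 2 / (c * ρbar) * (c * ρbar * ((T : ℝ) / 2 * (r * I))) * r = r * (T * r) * I := by
      field_simp
    rw [this, hrT, one_mul]
  rw [h5]
  calc _ ≤ 2 / (c * ρbar) * ((|v t₀ - lo| + 2 * (K * ρbar ^ 2)) * Real.log T) * r := by gcongr
    _ = _ := by ring

/-- Integrated form of an almost sure averaged inequality for finitely valued variables. -/
theorem integral_comp_indep_le {Ω : Type*} [MeasurableSpace Ω] {P : Measure Ω}
    [IsProbabilityMeasure P] {α β T : Type*} [MeasurableSpace α] [Finite α]
    [MeasurableSingletonClass α] [MeasurableSpace β] [Fintype β] [MeasurableSingletonClass β]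
    [MeasurableSpace T] [MeasurableSingletonClass T] {Y : Ω → α} {U : Ω → β} {Φ : α → T}
    {S : Ω → T} (hY : Measurable Y) (hU : Measurable U) (hind : IndepFun U Y P)
    (hS : ∀ ω, S ω = Φ (Y ω)) (f : β → T → ℝ) (b : T → ℝ)
    (h : ∀ᵐ ω ∂P, ∑ u, P.real {ω | U ω = u} * f u (S ω) ≤ b (S ω)) :
    ∫ ω, f (U ω) (S ω) ∂P ≤ ∫ ω, b (S ω) ∂P := by
  rw [integral_comp_indep hY hU hind hS]
  simp only [hS] at h ⊢
  exact integral_mono_ae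
    (integrable_comp_of_finite hY fun a => ∑ u, P.real {ω | U ω = u} * f u (Φ a))
    (integrable_comp_of_finite hY fun a => b (Φ a)) h

end SOBA

/-! ### Main theorem -/

theorem mainTheorem4
    {n m p d : ℕ}
    (F : Fin m → SOBA.Vec p → SOBA.Vec d → ℝ)
    (G : Fin n → SOBA.Vec p → SOBA.Vec d → ℝ)
    -- the directions make sense: each `F_j` is differentiable, each `G_i` twice differentiable
    (hFj : ∀ j, Differentiable ℝ (SOBA.joint (F j)))
    (hGi : ∀ i, Differentiable ℝ (SOBA.joint (G i)))
    (hGi' : ∀ i, Differentiable ℝ (gradient (SOBA.joint (G i))))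
    -- constants
    (μG CF Bz Bv Bx : ℝ) (L₁F L₂F L₁G L₂G L₃G : ℝ≥0)
    (hμG : 0 < μG) (hCF : 0 < CF) (hL₁F : 0 < L₁F) (hL₁G : 0 < L₁G)
    -- regularity of `F` and `G`
    (hF : SOBA.OuterRegular (SOBA.mean F) L₁F L₂F)
    (hG : SOBA.InnerRegular (SOBA.mean G) μG L₁G L₂G L₃G)
    (hbd : ∀ x, ‖SOBA.grad1 (SOBA.mean F) (SOBA.zStar (SOBA.mean G) x) x‖ ≤ CF)
    -- `h` is bounded below
    (hlow : BddBelow (Set.range (SOBA.value (SOBA.mean F) (SOBA.mean G))))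
    -- step sizes
    (ρbar ξ : ℝ) (hρbar : 0 < ρbar) (hξ : 0 < ξ)
    (hξmax : ξ ^ 2 ≤ SOBA.xiSqMax μG CF L₁F L₁G L₂G)
    (ρ γ : ℕ → ℝ)
    (hρ : ∀ t : ℕ, 1 ≤ t → ρ t = ρbar * (t : ℝ) ^ (-(1 / 2) : ℝ))
    (hγ : ∀ t : ℕ, 1 ≤ t → γ t = ξ * ρ t)
    -- sampling and SOBA iterates
    {Ω : Type*} [MeasurableSpace Ω] (P : Measure Ω) [IsProbabilityMeasure P]
    (i : ℕ → Ω → Fin n) (j : ℕ → Ω → Fin m) (hij : SOBA.IsUniformSampling P i j)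
    (s₁ : SOBA.State p d) (S : ℕ → Ω → SOBA.State p d)
    (hS : ∀ t ω, S t ω = SOBA.iterate F G ρ γ s₁ (fun k => i k ω) (fun k => j k ω) t)
    -- conditional second moments of the stochastic directions
    (hBz : ∀ t : ℕ, 1 ≤ t →
      SOBA.condOn P (S t) (fun ω => ‖SOBA.dirZ (G (i t ω)) (S t ω)‖ ^ 2) ≤ᵐ[P]
        fun ω => Bz ^ 2 * (1 + ‖SOBA.dirZ (SOBA.mean G) (S t ω)‖ ^ 2))
    (hBv : ∀ t : ℕ, 1 ≤ t →
      SOBA.condOn P (S t) (fun ω => ‖SOBA.dirV (F (j t ω)) (G (i t ω)) (S t ω)‖ ^ 2) ≤ᵐ[P]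
        fun ω => Bv ^ 2 * (1 + ‖SOBA.dirV (SOBA.mean F) (SOBA.mean G) (S t ω)‖ ^ 2))
    (hBx : ∀ t : ℕ, 1 ≤ t →
      SOBA.condOn P (S t) (fun ω => ‖SOBA.dirX (F (j t ω)) (G (i t ω)) (S t ω)‖ ^ 2) ≤ᵐ[P]
        fun _ => Bx ^ 2) :
    Differentiable ℝ (SOBA.value (SOBA.mean F) (SOBA.mean G)) ∧
    (fun T : ℕ => ⨅ t : Set.Icc 1 T,
        ∫ ω, ‖gradient (SOBA.value (SOBA.mean F) (SOBA.mean G)) (S t ω).2.2‖ ^ 2 ∂P)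
      =O[atTop] fun T : ℕ => Real.log T * (T : ℝ) ^ (-(1 / 2) : ℝ) := by
  have hgrad := SOBA.hasGradientAt_value hF hG hμG hbd
  refine ⟨fun x => (hgrad x).differentiableAt, ?_⟩
  obtain ⟨ω₀⟩ : Nonempty Ω := nonempty_of_isProbabilityMeasure P
  -- A probability space is nonempty, so a sampled index exists and the averages run over nonempty
  -- sets.
  have hn : n ≠ 0 := by rintro rfl; exact (i 0 ω₀).elim0
  have hm : m ≠ 0 := by rintro rfl; exact (j 0 ω₀).elim0
  obtain ⟨cz, cv, κ, K, hcz, hcv, hκ, hK, hstep⟩ := SOBA.exists_lyapunov_descent hF hG hμG hCF hL₁F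
    hL₁G hbd hξ hξmax Bz Bv Bx
  obtain ⟨lo, hlo⟩ := hlow
  have hlo' : ∀ s, lo ≤ SOBA.lyapunov (SOBA.mean F) (SOBA.mean G) cz cv s := fun s => by
    have h1 : lo ≤ SOBA.value (SOBA.mean F) (SOBA.mean G) s.2.2 := hlo ⟨_, rfl⟩
    have h2 : 0 ≤ cz * ‖s.1 - SOBA.zStar (SOBA.mean G) s.2.2‖ ^ 2
      + cv * ‖s.2.1 - SOBA.vStar (SOBA.mean F) (SOBA.mean G) s.2.2‖ ^ 2 := by positivity
    rw [SOBA.lyapunov]; linarith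
  choose Φ hΦ using fun t => SOBA.exists_iterate_eq_past (i := i) (j := j) F G ρ γ s₁ t
  have hSΦ : ∀ t ω, S t ω = Φ t (SOBA.past i j t ω) := fun t ω => (hS t ω).trans (hΦ t ω)
  have hint : ∀ (φ : SOBA.State p d → ℝ) t, Integrable (fun ω => φ (S t ω)) P := fun φ t => by
    simp only [hSΦ]
    exact SOBA.integrable_comp_of_finite (hij.measurable_past t) fun a => φ (Φ t a)
  -- Since $\overline\rho$ is arbitrary, early steps may be too large for descent. They are skipped,
  -- at the cost of a finite expected Lyapunov value at $t_0$.
  obtain ⟨t₀, ht₀, hsmall⟩ : ∃ t₀ : ℕ, 1 ≤ t₀ ∧ ∀ t : ℕ, t₀ ≤ t → 0 ≤ κ - K * ρ t := by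
    have h1 : Tendsto (fun t : ℕ => κ - K * (ρbar * (t : ℝ) ^ (-(1 / 2) : ℝ))) atTop
        (𝓝 (κ - K * (ρbar * 0))) :=
      ((((tendsto_rpow_neg_atTop (by norm_num : (0 : ℝ) < 1 / 2)).comp
        tendsto_natCast_atTop_atTop).const_mul ρbar).const_mul K).const_sub κ
    have h2 := (h1.eventually (lt_mem_nhds (by simpa using hκ : 0 < κ - K * (ρbar * 0)))).and
      (eventually_ge_atTop 1)
    obtain ⟨t₀, h3⟩ := eventually_atTop.1 h2
    exact ⟨t₀, (h3 t₀ le_rfl).2, fun t ht => by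
      rw [hρ t (h3 t ht).2]; exact (h3 t ht).1.le⟩
  have hgv : gradient (SOBA.value (SOBA.mean F) (SOBA.mean G))
      = SOBA.valueGrad (SOBA.mean F) (SOBA.mean G) := gradient_eq hgrad
  rw [hgv]
  refine SOBA.isBigO_iInf_of_descent
    (v := fun t => ∫ ω, SOBA.lyapunov (SOBA.mean F) (SOBA.mean G) cz cv (S t ω) ∂P)
    (g := fun t => ∫ ω, ‖SOBA.valueGrad (SOBA.mean F) (SOBA.mean G) (S t ω).2.2‖ ^ 2 ∂P)
    (lo := lo) (c := ξ / 2) (K := K) hρbar (by positivity) hK ht₀ (fun t => ?_)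
    (fun t => integral_nonneg fun ω => by positivity) (fun t ht => ?_)
  · have h1 := integral_mono (integrable_const (μ := P) lo) (hint _ t) fun ω => hlo' (S t ω)
    simpa using h1
  have ht1 : 1 ≤ t := ht₀.trans ht
  rw [← hρ t ht1]
  have hρpos : 0 < ρ t := by
    rw [hρ t ht1]
    have : (0 : ℝ) < t := by exact_mod_cast ht1
    positivity
  have hq := fun u => hij.real_pair t u
  have hcond := fun f : Fin n × Fin m → SOBA.State p d → ℝ =>
    SOBA.condExp_comp_indep (hij.measurable_past t) (hij.measurable_pair t) (hij.indepFun_past t)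
      (hSΦ t) f
  simp only [hq] at hcond
  have hmz := hcond fun u s => ‖SOBA.dirZ (G u.1) s‖ ^ 2
  have hmv := hcond fun u s => ‖SOBA.dirV (F u.2) (G u.1) s‖ ^ 2
  have hmx := hcond fun u s => ‖SOBA.dirX (F u.2) (G u.1) s‖ ^ 2
  have hq1 : ∑ _u : Fin n × Fin m, 1 / (n : ℝ) * (1 / (m : ℝ)) = 1 := by
    have hn' : (n : ℝ) ≠ 0 := Nat.cast_ne_zero.2 hn
    have hm' : (m : ℝ) ≠ 0 := Nat.cast_ne_zero.2 hm
    simp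
    field_simp
  have hdesc := SOBA.integral_comp_indep_le (hij.measurable_past t) (hij.measurable_pair t)
    (hij.indepFun_past t) (hSΦ t)
    (fun u s => SOBA.lyapunov (SOBA.mean F) (SOBA.mean G) cz cv
      (SOBA.step (F u.2) (G u.1) (ρ t) (γ t) s))
    (fun s => SOBA.lyapunov (SOBA.mean F) (SOBA.mean G) cz cv s
      - ξ / 2 * ρ t * ‖SOBA.valueGrad (SOBA.mean F) (SOBA.mean G) s.2.2‖ ^ 2 + K * ρ t ^ 2) (by
    simp only [hq]
    -- Almost surely, the conditional second moments equal the finite uniform averages over index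
    -- pairs, so the moment assumptions become the hypotheses of the one-step descent.
    filter_upwards [hmz, hmv, hmx, hBz t ht1, hBv t ht1, hBx t ht1] with ω hz hv hx bz bv bx
    have h1 := hstep (fun _ : Fin n × Fin m => 1 / (n : ℝ) * (1 / (m : ℝ)))
      (fun _ => by positivity) hq1 (S t ω) (fun u => SOBA.dirZ (G u.1) (S t ω))
      (fun u => SOBA.dirV (F u.2) (G u.1) (S t ω)) (fun u => SOBA.dirX (F u.2) (G u.1) (S t ω))
      (ρ t) hρpos (SOBA.sum_smul_dirZ hGi hn hm _) (SOBA.sum_smul_dirV hFj hGi hGi' hn hm _)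
      (SOBA.sum_smul_dirX hFj hGi hGi' hn hm _) (hz.symm.trans_le bz) (hv.symm.trans_le bv)
      (hx.symm.trans_le bx)
    rw [← hγ t ht1] at h1
    refine h1.trans ?_
    -- For $t\ge t_0$ the tracking-error term has a favourable sign and is dropped.
    have h2 := mul_nonneg (mul_nonneg hρpos.le (hsmall t ht))
      (by positivity : 0 ≤ ‖(S t ω).1 - SOBA.zStar (SOBA.mean G) (S t ω).2.2‖ ^ 2
        + ‖(S t ω).2.1 - SOBA.vStar (SOBA.mean F) (SOBA.mean G) (S t ω).2.2‖ ^ 2)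
    have h3 : γ t = ξ * ρ t := hγ t ht1
    rw [h3]
    linarith)
  have hSs : ∀ ω, S (t + 1) ω = SOBA.step (F (j t ω)) (G (i t ω)) (ρ t) (γ t) (S t ω) := fun ω => by
    rw [hS, SOBA.iterate_succ _ _ _ _ _ ht1, ← hS]
  simp only [hSs]
  refine hdesc.trans_eq ?_
  have hV := hint (SOBA.lyapunov (SOBA.mean F) (SOBA.mean G) cz cv) t
  have hN := (hint (fun s => ‖SOBA.valueGrad (SOBA.mean F) (SOBA.mean G) s.2.2‖ ^ 2) t).const_mul
    (ξ / 2 * ρ t)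
  have hVN : Integrable (fun ω => SOBA.lyapunov (SOBA.mean F) (SOBA.mean G) cz cv (S t ω)
      - ξ / 2 * ρ t * ‖SOBA.valueGrad (SOBA.mean F) (SOBA.mean G) (S t ω).2.2‖ ^ 2) P := hV.sub hN
  rw [integral_add hVN (integrable_const _), integral_sub hV hN, integral_const_mul]
  simp
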